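/- Let $D,L\ge 1$, let $\Gamma\in\mathbb R^{L\times L}$ be symmetric positive definite, $\Sigma\in\mathbb R^{D\times D}$ diagonal with positive diagonal entries, and $A\in\mathbb R^{D\times L}$. For $M\in\mathbb R^{D\times L}$ put $$g(M)=(\Gamma^{-1}+M^\top\Sigma^{-1}M)^{-1}M^\top\Sigma^{-1}\in\mathbb R^{L\times D},$$ and let $A^\star=g(A)$, $\Sigma^\star=(\Gamma^{-1}+A^\top\Sigma^{-1}A)^{-1}$, $\Gamma^\star=\Sigma+A\Gamma A^\top$. Let $(X_i,Y_i)_{i\ge1}$ be an i.i.d. sequence with $X_i\sim\mathcal N_D(0,\Gamma^\star)$ and $Y_i=A^\star X_i+\varepsilon_i$, where $\varepsilon_i\sim\mathcal N_L(0,\Sigma^\star)$ is independent of $X_i$ (equivalently, $Y_i\sim\mathcal N_L(0,\Gamma)$ and $X_i=AY_i+e_i$ with $e_i\sim\mathcal N_D(0,\Sigma)$ independent of $Y_i$). With the data matrices $\mathbf X=(X_1,\dots,X_N)\in\mathbb R^{D\times N}$ and $\mathbf Y=(Y_1,\dots,Y_N)\in\mathbb R^{L\times N}$, define the estimators ($\Gamma$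 and $\Sigma$ being known) $$\widehat A=\widehat A_N=\mathbf X\mathbf Y^\top(\mathbf Y\mathbf Y^\top)^{-1},\qquad \widehat A^\star=\widehat A^\star_N=g(\widehat A_N),$$ and let $$\Theta(A)=\Theta_N(A)=\mathrm{Cov}\big(\mathrm{vec}(Dg(A).(\widehat A_N-A))\big)\in\mathbb R^{DL\times DL},$$ where $Dg(A)$ is the differential of $g$ at $A$ and $\mathrm{vec}$ stacks the columns of a matrix. Assume that $\Theta_N(A)$ is invertible for all sufficiently large $N$ (this holds exactly when $Dg(A)$ is invertible). Let $0<\alpha<1$ and let $\chi^2_{DL}(1-\alpha)$ be the $(1-\alpha)$-quantile of the $\chi^2$ distribution with $DL$ degrees of freedom. Then, for all sufficiently large $N$, the entries of $Dg(A).(\widehat A_N-A)$ are square integrable (so that $\Theta_N(A)$ is well defined), and the ellipsoid $$\widetilde{\mathcal R}_{N}=\Big\{a^\star\in\mathbb R^{L\times D}:\ \mathrm{vec}(a^\star-\widehat A^\star_N)^\top\,\Theta_N(A)^{-1}\,\mathrm{vec}(a^\star-\widehat A^\star_N)\le\chi^2_{DL}(1-\alpha)\Big\}$$ is an asymptotic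 confidence region of level $1-\alpha$ for $A^\star$: $$\mathbb P\big(A^\star\in\widetilde{\mathcal R}_{N}\big)\xrightarrow[N\to\infty]{}1-\alpha .$$ -/

import Mathlib

open MeasureTheory ProbabilityTheory Filter Topology Matrix

noncomputable section

namespace InverseRegression

/-- Conditional covariance of the response: `Σ⋆ = (Γ⁻¹ + Aᵀ Σ⁻¹ A)⁻¹`. -/
def sigmaStar {D L : ℕ} (Γ : Matrix (Fin L) (Fin L) ℝ) (S : Matrix (Fin D) (Fin D) ℝ)
    (A : Matrix (Fin D) (Fin L) ℝ) : Matrix (Fin L) (Fin L) ℝ :=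
  (Γ⁻¹ + Aᵀ * S⁻¹ * A)⁻¹

/-- The map `g : A ↦ A⋆ = (Γ⁻¹ + Aᵀ Σ⁻¹ A)⁻¹ Aᵀ Σ⁻¹`, for fixed `Γ` and `Σ`. -/
def g {D L : ℕ} (Γ : Matrix (Fin L) (Fin L) ℝ) (S : Matrix (Fin D) (Fin D) ℝ)
    (A : Matrix (Fin D) (Fin L) ℝ) : Matrix (Fin L) (Fin D) ℝ :=
  (Γ⁻¹ + Aᵀ * S⁻¹ * A)⁻¹ * Aᵀ * S⁻¹

/-- The map `Ψ : (Γ, A, Σ) ↦ (Γ⋆, A⋆, Σ⋆)` from the parameters of the inverse regression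
`Y ∼ N(0, Γ)`, `X = A Y + e`, `e ∼ N(0, Σ)`, to those of the forward regression
`X ∼ N(0, Γ⋆)`, `Y = A⋆ X + ε`, `ε ∼ N(0, Σ⋆)`. -/
def Psi {D L : ℕ} (Γ : Matrix (Fin L) (Fin L) ℝ) (A : Matrix (Fin D) (Fin L) ℝ)
    (S : Matrix (Fin D) (Fin D) ℝ) :
    Matrix (Fin D) (Fin D) ℝ × Matrix (Fin L) (Fin D) ℝ × Matrix (Fin L) (Fin L) ℝ :=
  (S + A * Γ * Aᵀ, g Γ S A, sigmaStar Γ S A)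

/-- `(X i, Y i)` is an i.i.d. sequence from the forward regression model: `X i ∼ N(0, Γ⋆)` and
`Y i = A⋆ (X i) + ε i` with `ε i ∼ N(0, Σ⋆)` independent of `X i`. -/
structure IsForwardSample {Ω : Type*} [MeasurableSpace Ω] (P : Measure Ω) {D L : ℕ}
    (Γs : Matrix (Fin D) (Fin D) ℝ) (As : Matrix (Fin L) (Fin D) ℝ)
    (Ss : Matrix (Fin L) (Fin L) ℝ)
    (X : ℕ → Ω → EuclideanSpace ℝ (Fin D)) (Y : ℕ → Ω → EuclideanSpace ℝ (Fin L)) : Prop where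
  indep : iIndepFun (fun i ω => (X i ω, Y i ω)) P
  law_covariate : ∀ i, HasLaw (X i) (multivariateGaussian 0 Γs) P
  law_noise : ∀ i, HasLaw (fun ω => Y i ω - toEuclideanLin As (X i ω))
    (multivariateGaussian 0 Ss) P
  indep_noise : ∀ i, IndepFun (X i) (fun ω => Y i ω - toEuclideanLin As (X i ω)) P

/-- The `k × N` data matrix whose columns are the first `N` observations. -/
def dataMatrix {Ω : Type*} {k : ℕ} (Z : ℕ → Ω → EuclideanSpace ℝ (Fin k)) (N : ℕ) (ω : Ω) :
    Matrix (Fin k) (Fin N) ℝ :=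
  Matrix.of fun j i => Z i ω j

/-- Least squares estimator `Â = X Yᵀ (Y Yᵀ)⁻¹` of the `D × L` inverse slope matrix, from the
`D × N` and `L × N` data matrices of the first `N` observations. -/
def AHat {Ω : Type*} {D L : ℕ} (X : ℕ → Ω → EuclideanSpace ℝ (Fin D))
    (Y : ℕ → Ω → EuclideanSpace ℝ (Fin L)) (N : ℕ) (ω : Ω) : Matrix (Fin D) (Fin L) ℝ :=
  dataMatrix X N ω * (dataMatrix Y N ω)ᵀ * (dataMatrix Y N ω * (dataMatrix Y N ω)ᵀ)⁻¹

/-- Estimator `Â⋆ = g(Â)` of the forward slope matrix (`Γ` and `Σ` known). -/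
def AStarHat {Ω : Type*} {D L : ℕ} (Γ : Matrix (Fin L) (Fin L) ℝ) (S : Matrix (Fin D) (Fin D) ℝ)
    (X : ℕ → Ω → EuclideanSpace ℝ (Fin D)) (Y : ℕ → Ω → EuclideanSpace ℝ (Fin L))
    (N : ℕ) (ω : Ω) : Matrix (Fin L) (Fin D) ℝ :=
  g Γ S (AHat X Y N ω)

/-- The random vector `vec (Dg(A) (Â - A))`, where `Dg(A)` is the Fréchet derivative of `g`
at `A`. -/
def linearizedError {Ω : Type*} {D L : ℕ} (Γ : Matrix (Fin L) (Fin L) ℝ)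
    (S : Matrix (Fin D) (Fin D) ℝ) (A : Matrix (Fin D) (Fin L) ℝ)
    (X : ℕ → Ω → EuclideanSpace ℝ (Fin D)) (Y : ℕ → Ω → EuclideanSpace ℝ (Fin L))
    (N : ℕ) (ω : Ω) : Fin D × Fin L → ℝ :=
  vec (fderiv ℝ (g Γ S) A (AHat X Y N ω - A))

/-- The covariance matrix `Θ(A) = Cov (vec (Dg(A) (Â - A)))` at sample size `N`. -/
def Theta {Ω : Type*} [MeasurableSpace Ω] (P : Measure Ω) {D L : ℕ}
    (Γ : Matrix (Fin L) (Fin L) ℝ) (S : Matrix (Fin D) (Fin D) ℝ) (A : Matrix (Fin D) (Fin L) ℝ)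
    (X : ℕ → Ω → EuclideanSpace ℝ (Fin D)) (Y : ℕ → Ω → EuclideanSpace ℝ (Fin L)) (N : ℕ) :
    Matrix (Fin D × Fin L) (Fin D × Fin L) ℝ :=
  Matrix.of fun p q => covariance (fun ω => linearizedError Γ S A X Y N ω p)
    (fun ω => linearizedError Γ S A X Y N ω q) P

/-- The chi-squared distribution with `k` degrees of freedom: the law of the sum of the squares of
`k` independent standard normal variables. -/
def chiSq (k : ℕ) : Measure ℝ :=
  (Measure.pi fun _ : Fin k => gaussianReal 0 1).map fun x => ∑ i, x i ^ 2

/-- The quantile of order `p` of the chi-squared distribution with `k` degrees of freedom. -/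
def chiSqQuantile (k : ℕ) (p : ℝ) : ℝ :=
  sInf {x : ℝ | p ≤ (chiSq k).real (Set.Iic x)}

/-- The ellipsoid of the matrices `a⋆` such that
`vec(a⋆ - Â⋆)ᵀ Θ(A)⁻¹ vec(a⋆ - Â⋆) ≤ χ²_{DL}(1 - α)`, at sample size `N`. -/
def confidenceRegion {Ω : Type*} [MeasurableSpace Ω] (P : Measure Ω) {D L : ℕ}
    (Γ : Matrix (Fin L) (Fin L) ℝ) (S : Matrix (Fin D) (Fin D) ℝ) (A : Matrix (Fin D) (Fin L) ℝ)
    (X : ℕ → Ω → EuclideanSpace ℝ (Fin D)) (Y : ℕ → Ω → EuclideanSpace ℝ (Fin L))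
    (α : ℝ) (N : ℕ) (ω : Ω) : Set (Matrix (Fin L) (Fin D) ℝ) :=
  {a | vec (a - AStarHat Γ S X Y N ω) ⬝ᵥ
      ((Theta P Γ S A X Y N)⁻¹ *ᵥ vec (a - AStarHat Γ S X Y N ω)) ≤ chiSqQuantile (D * L) (1 - α)}

end InverseRegression

end

/-! By comparing characteristic functions, the forward sample is also an inverse regression: X = AY
+ e with Y ∼ N(0, Γ) and e ∼ N(0, Σ) independent (`map_forward_eq_prod`). Write W = YYᵀ for the Gram
matrix of the regressors and J for the matrix of Dg(A). When W is invertible, Â - A = eYᵀW⁻¹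
(`lsError`). Given the regressors this is centred Gaussian with covariance Σ ⊗ W⁻¹. The strong law
gives N W⁻¹ → Γ⁻¹, so √N(Â - A) converges in law to N(0, K) with K = Σ ⊗ Γ⁻¹
(`tendstoInDistribution_scaledError`); no central limit theorem is needed. The delta method carries
this over to g(Â).

The ellipsoid is built on the true covariance Θ = J(Σ ⊗ E[W⁻¹])Jᵀ (`Theta_eq`), so almost sure
convergence of N W⁻¹ is not enough: the means must converge too. This is an inverse Wishart moment
problem. Whitening by Γ^(-1/2) reduces it to standard Gaussian regressors. There Stein's identity,
applied to (δI + W)⁻¹ so that every function involved is bounded, gives E tr(δI + W)⁻¹ ≤ L/(N - L -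
1) uniformly in δ when N > L + 1. Letting δ → 0 shows that W is almost surely invertible and that
W⁻¹ has the same trace bound. Since N times this bound tends to L, the almost sure limit of N tr W⁻¹
in the standard case, no mass escapes and N E[W⁻¹] converges (`tendsto_integral_inv_gram`).

Hence NΘ → JKJᵀ, which is invertible because Θ is eventually invertible. By Slutsky the quadratic
form of the ellipsoid converges in law to zᵀK⁻¹z with z ∼ N(0, K), the Jacobian having cancelled.
This limit is χ² with DL degrees of freedom and has no atoms, so the coverage tends to its
distribution function at the quantile, namely 1 - α. -/

namespace InverseRegression

/-! ### Deterministic bounds for the inverse of a ridge-regularised Gram matrix. -/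

section LinearAlgebra

variable {ι n : Type*} [Fintype ι] [Fintype n] [DecidableEq n]

/-- The matrix `∑ i, z i (z i)ᵀ`. -/
def sumOuter (z : ι → n → ℝ) : Matrix n n ℝ := Matrix.of fun a b => ∑ i, z i a * z i b

/-- The regularised matrix `δ I + ∑ i, z i (z i)ᵀ`. -/
def ridge (δ : ℝ) (z : ι → n → ℝ) : Matrix n n ℝ := δ • (1 : Matrix n n ℝ) + sumOuter z

omit [Fintype n] [DecidableEq n] in
lemma sumOuter_apply (z : ι → n → ℝ) (a b : n) : sumOuter z a b = ∑ i, z i a * z i b := rfl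

omit [Fintype n] [DecidableEq n] in
lemma isHermitian_sumOuter (z : ι → n → ℝ) : (sumOuter z).IsHermitian := by
  ext a b; simp [sumOuter_apply, mul_comm]

omit [DecidableEq n] in
lemma dotProduct_sumOuter_mulVec (z : ι → n → ℝ) (u v : n → ℝ) :
    u ⬝ᵥ (sumOuter z *ᵥ v) = ∑ i, (z i ⬝ᵥ u) * (z i ⬝ᵥ v) := by
  simp only [dotProduct, mulVec, sumOuter_apply, Finset.mul_sum, Finset.sum_mul]
  rw [Finset.sum_comm_cycle]
  refine Finset.sum_congr rfl fun i _ => ?_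
  refine Finset.sum_comm.trans ?_
  refine Finset.sum_congr rfl fun a _ => Finset.sum_congr rfl fun b _ => by ring

omit [DecidableEq n] in
lemma posSemidef_sumOuter (z : ι → n → ℝ) : (sumOuter z).PosSemidef := by
  refine .of_dotProduct_mulVec_nonneg (isHermitian_sumOuter z) fun v => ?_
  simp only [star_trivial, dotProduct_sumOuter_mulVec]
  exact Finset.sum_nonneg fun i _ => mul_self_nonneg _

lemma posDef_ridge {δ : ℝ} (hδ : 0 < δ) (z : ι → n → ℝ) : (ridge δ z).PosDef :=
  (Matrix.PosDef.one.smul hδ).add_posSemidef (posSemidef_sumOuter z)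

lemma dotProduct_ridge_mulVec (δ : ℝ) (z : ι → n → ℝ) (u v : n → ℝ) :
    u ⬝ᵥ (ridge δ z *ᵥ v) = δ * (u ⬝ᵥ v) + ∑ i, (z i ⬝ᵥ u) * (z i ⬝ᵥ v) := by
  rw [ridge, add_mulVec, dotProduct_add, dotProduct_sumOuter_mulVec, smul_mulVec, one_mulVec,
    dotProduct_smul, smul_eq_mul]

variable {δ : ℝ} (hδ : 0 < δ) (z : ι → n → ℝ)
include hδ

lemma isUnit_det_ridge : IsUnit (ridge δ z).det :=
  (posDef_ridge hδ z).det_pos.ne'.isUnit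

lemma ridge_mul_inv : ridge δ z * (ridge δ z)⁻¹ = 1 := mul_nonsing_inv _ (isUnit_det_ridge hδ z)

lemma inv_ridge_mul : (ridge δ z)⁻¹ * ridge δ z = 1 := nonsing_inv_mul _ (isUnit_det_ridge hδ z)

/-- Evaluates the quadratic form of the ridge matrix at w = (ridge)⁻¹v. All the bounds below drop
terms of this identity. -/
lemma dotProduct_inv_ridge_mulVec_self (v : n → ℝ) :
    v ⬝ᵥ ((ridge δ z)⁻¹ *ᵥ v) = δ * ((ridge δ z)⁻¹ *ᵥ v ⬝ᵥ (ridge δ z)⁻¹ *ᵥ v) +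
      ∑ i, (z i ⬝ᵥ (ridge δ z)⁻¹ *ᵥ v) ^ 2 := by
  have h : ridge δ z *ᵥ ((ridge δ z)⁻¹ *ᵥ v) = v := by
    rw [mulVec_mulVec, ridge_mul_inv hδ, one_mulVec]
  have h2 := dotProduct_ridge_mulVec δ z ((ridge δ z)⁻¹ *ᵥ v) ((ridge δ z)⁻¹ *ᵥ v)
  rw [h, dotProduct_comm] at h2
  simpa [sq] using h2

omit [DecidableEq n] hδ in
lemma dotProduct_self_nonneg' (v : n → ℝ) : 0 ≤ v ⬝ᵥ v :=
  Finset.sum_nonneg fun _ _ => mul_self_nonneg _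

lemma inv_ridge_quadratic_nonneg (v : n → ℝ) : 0 ≤ v ⬝ᵥ ((ridge δ z)⁻¹ *ᵥ v) := by
  rw [dotProduct_inv_ridge_mulVec_self hδ]
  exact add_nonneg (mul_nonneg hδ.le (dotProduct_self_nonneg' _))
    (Finset.sum_nonneg fun _ _ => sq_nonneg _)

/-- Call the left side q. The preceding identity at v = z i contains q² as one of its nonnegative
terms, so q² ≤ q. -/
lemma inv_ridge_quadratic_le_one (i : ι) : z i ⬝ᵥ ((ridge δ z)⁻¹ *ᵥ z i) ≤ 1 := by
  have h := dotProduct_inv_ridge_mulVec_self hδ z (z i)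
  have h1 := mul_nonneg hδ.le (dotProduct_self_nonneg' ((ridge δ z)⁻¹ *ᵥ z i))
  have h2 := Finset.single_le_sum (f := fun j => (z j ⬝ᵥ (ridge δ z)⁻¹ *ᵥ z i) ^ 2)
    (fun j _ => sq_nonneg _) (Finset.mem_univ i)
  nlinarith

lemma inv_ridge_mulVec_sq_le (i : ι) (a : n) : ((ridge δ z)⁻¹ *ᵥ z i) a ^ 2 ≤ δ⁻¹ := by
  have h := dotProduct_inv_ridge_mulVec_self hδ z (z i)
  have h0 := inv_ridge_quadratic_le_one hδ z i
  have h1 : 0 ≤ ∑ j, (z j ⬝ᵥ (ridge δ z)⁻¹ *ᵥ z i) ^ 2 := Finset.sum_nonneg fun j _ => sq_nonneg _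
  have h2 := Finset.single_le_sum
    (f := fun a => ((ridge δ z)⁻¹ *ᵥ z i) a * ((ridge δ z)⁻¹ *ᵥ z i) a)
    (fun j _ => mul_self_nonneg _) (Finset.mem_univ a)
  change _ ≤ ((ridge δ z)⁻¹ *ᵥ z i) ⬝ᵥ ((ridge δ z)⁻¹ *ᵥ z i) at h2
  rw [inv_eq_one_div δ, le_div_iff₀ hδ]
  nlinarith

lemma inv_ridge_diag_nonneg (a : n) : 0 ≤ (ridge δ z)⁻¹ a a :=
  (posDef_ridge hδ z).inv.posSemidef.diag_nonneg

/-- With R the inverse, the identity at a basis vector gives R a a ≥ δ‖R e_a‖² ≥ δ (R a a)². -/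
lemma inv_ridge_diag_le (a : n) : (ridge δ z)⁻¹ a a ≤ δ⁻¹ := by
  have h := dotProduct_inv_ridge_mulVec_self hδ z (Pi.single a 1)
  simp only [mulVec_single_one, single_one_dotProduct, Matrix.col_apply] at h
  have h1 : 0 ≤ ∑ j, (z j ⬝ᵥ (ridge δ z)⁻¹.col a) ^ 2 := Finset.sum_nonneg fun j _ => sq_nonneg _
  have h2 := Finset.single_le_sum
    (f := fun b => (ridge δ z)⁻¹.col a b * (ridge δ z)⁻¹.col a b)
    (fun j _ => mul_self_nonneg _) (Finset.mem_univ a)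
  change _ ≤ (ridge δ z)⁻¹.col a ⬝ᵥ (ridge δ z)⁻¹.col a at h2
  simp only [Matrix.col_apply] at h2
  have h3 := inv_ridge_diag_nonneg hδ z a
  rw [inv_eq_one_div δ, le_div_iff₀ hδ]
  by_contra! hc
  have h4 := mul_le_mul_of_nonneg_left h2 hδ.le
  have h5 : 0 < (ridge δ z)⁻¹ a a := h3.lt_of_ne fun h0 => by rw [← h0] at hc; linarith
  nlinarith

/-- The sum is the trace of (ridge)⁻¹ times the Gram matrix, and that product equals 1 - δ
(ridge)⁻¹. -/
lemma sum_inv_ridge_quadratic :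
    ∑ i, z i ⬝ᵥ ((ridge δ z)⁻¹ *ᵥ z i) = Fintype.card n - δ * ((ridge δ z)⁻¹).trace := by
  have h : (ridge δ z)⁻¹ * sumOuter z = 1 - δ • (ridge δ z)⁻¹ := by
    have := inv_ridge_mul hδ z
    conv at this => enter [1, 2]; rw [ridge]
    rw [mul_add, mul_smul_comm, mul_one] at this
    exact eq_sub_of_add_eq' this
  have h2 : ((ridge δ z)⁻¹ * sumOuter z).trace = ∑ i, z i ⬝ᵥ ((ridge δ z)⁻¹ *ᵥ z i) := by
    simp only [Matrix.trace, Matrix.diag, Matrix.mul_apply, sumOuter_apply, dotProduct, mulVec,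
      Finset.mul_sum]
    rw [Finset.sum_comm_cycle]
    refine Finset.sum_congr rfl fun i _ => Finset.sum_comm.trans ?_
    refine Finset.sum_comm.trans (Finset.sum_congr rfl fun a _ => Finset.sum_congr rfl fun b _ => ?_)
    ring
  rw [← h2, h, trace_sub, trace_one, trace_smul, smul_eq_mul]

/-- By symmetry of R = (ridge)⁻¹, the sum over i at fixed a is R a a - δ‖R e_a‖². -/
lemma sum_inv_ridge_normSq_le :
    ∑ i, ∑ a, ((ridge δ z)⁻¹ *ᵥ z i) a ^ 2 ≤ ((ridge δ z)⁻¹).trace := by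
  have hsymm : ∀ a b, (ridge δ z)⁻¹ a b = (ridge δ z)⁻¹ b a := fun a b => by
    simpa using (posDef_ridge hδ z).inv.1.apply b a
  rw [Finset.sum_comm, Matrix.trace]
  refine Finset.sum_le_sum fun a _ => ?_
  have h := dotProduct_inv_ridge_mulVec_self hδ z (Pi.single a 1)
  simp only [mulVec_single_one, single_one_dotProduct, Matrix.col_apply] at h
  have h1 := mul_nonneg hδ.le (dotProduct_self_nonneg' ((ridge δ z)⁻¹.col a))
  rw [Matrix.diag_apply, h]
  refine le_add_of_nonneg_of_le h1 (le_of_eq ?_)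
  refine Finset.sum_congr rfl fun i _ => ?_
  congr 1
  simp only [mulVec, dotProduct, Matrix.col_apply]
  exact Finset.sum_congr rfl fun b _ => by rw [hsymm a b, mul_comm]

end LinearAlgebra

/-! ### Derivative of the matrix inverse along a curve. -/

section Derivative

variable {n : Type*} [Fintype n] [DecidableEq n]

/-- The resolvent identity writes the difference quotient of the inverse as -M(s)⁻¹ · slope ·
M(t)⁻¹, and continuity of inversion gives the limit. -/
lemma hasDerivAt_matrix_inv {M : ℝ → Matrix n n ℝ} {M' : Matrix n n ℝ} {t : ℝ}
    (hM : ∀ a b, HasDerivAt (fun s => M s a b) (M' a b) t) (hu : ∀ s, IsUnit (M s).det) (a b : n) :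
    HasDerivAt (fun s => (M s)⁻¹ a b) (-((M t)⁻¹ * M' * (M t)⁻¹) a b) t := by
  have hc : ContinuousAt M t :=
    continuousAt_pi.2 fun a => continuousAt_pi.2 fun b => (hM a b).continuousAt
  have hci : ContinuousAt (fun s => (M s)⁻¹) t := by
    refine ContinuousAt.comp (g := fun A : Matrix n n ℝ => A⁻¹) ?_ hc
    refine continuousAt_matrix_inv _ ?_
    rw [Ring.inverse_eq_inv']
    exact continuousAt_inv₀ (hu t).ne_zero
  have hci' : Tendsto (fun s => (M s)⁻¹) (𝓝[≠] t) (𝓝 (M t)⁻¹) := hci.tendsto.mono_left inf_le_left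
  have hs : Tendsto (fun s => Matrix.of fun a b => slope (fun s => M s a b) t s) (𝓝[≠] t)
      (𝓝 M') :=
    tendsto_pi_nhds.2 fun a => tendsto_pi_nhds.2 fun b => (hasDerivAt_iff_tendsto_slope.1 (hM a b))
  have hp : Tendsto (fun s => -((M s)⁻¹ * (Matrix.of fun a b => slope (fun s => M s a b) t s) *
      (M t)⁻¹)) (𝓝[≠] t) (𝓝 (-((M t)⁻¹ * M' * (M t)⁻¹))) :=
    ((hci'.mul hs).mul tendsto_const_nhds).neg
  rw [hasDerivAt_iff_tendsto_slope]
  have hp2 := tendsto_pi_nhds.1 (tendsto_pi_nhds.1 hp a) b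
  refine hp2.congr' ?_
  filter_upwards [self_mem_nhdsWithin] with s hs
  have e1 : (Matrix.of fun a b => slope (fun s => M s a b) t s) = (s - t)⁻¹ • (M s - M t) := by
    ext; simp [slope]
  have e2 : (M s)⁻¹ * (M s - M t) * (M t)⁻¹ = (M t)⁻¹ - (M s)⁻¹ := by
    rw [mul_sub, sub_mul, nonsing_inv_mul _ (hu s), one_mul, mul_assoc, mul_nonsing_inv _ (hu t),
      mul_one]
  rw [e1, mul_smul_comm, smul_mul_assoc, e2]
  simp [slope, ← mul_neg]

end Derivative

/-! ### Gaussian integration by parts, in one coordinate and in product spaces. -/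

section Stein

lemma hasDerivAt_gaussianPDFReal (x : ℝ) :
    HasDerivAt (gaussianPDFReal 0 1) (-(x * gaussianPDFReal 0 1 x)) x := by
  have h : HasDerivAt (fun x : ℝ => -(x - 0) ^ 2 / (2 * ((1 : NNReal) : ℝ))) (-x) x := by
    have := (((hasDerivAt_id x).sub_const 0).pow 2).neg.div_const (2 * ((1 : NNReal) : ℝ))
    convert! this using 1
    simp; ring
  have h2 := (h.exp).const_mul (√(2 * Real.pi * ((1 : NNReal) : ℝ)))⁻¹
  convert! h2 using 1
  rw [gaussianPDFReal]; ring

lemma integrable_gaussianReal_iff {f : ℝ → ℝ} :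
    Integrable f (gaussianReal 0 1) ↔ Integrable (fun x => gaussianPDFReal 0 1 x * f x) := by
  rw [gaussianReal_of_var_ne_zero _ one_ne_zero,
    integrable_withDensity_iff_integrable_smul' (measurable_gaussianPDF _ _)
      (ae_of_all _ fun _ => gaussianPDF_lt_top)]
  simp [toReal_gaussianPDF]

/-- **Stein's identity** for the standard normal distribution. -/
lemma integral_mul_gaussianReal_eq_integral_deriv {f f' : ℝ → ℝ}
    (hf : ∀ x, HasDerivAt f (f' x) x) (h1 : Integrable f (gaussianReal 0 1))
    (h2 : Integrable f' (gaussianReal 0 1))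
    (h3 : Integrable (fun x => x * f x) (gaussianReal 0 1)) :
    ∫ x, x * f x ∂(gaussianReal 0 1) = ∫ x, f' x ∂(gaussianReal 0 1) := by
  rw [integrable_gaussianReal_iff] at h1 h2 h3
  rw [integral_gaussianReal_eq_integral_smul one_ne_zero,
    integral_gaussianReal_eq_integral_smul one_ne_zero]
  -- The density φ satisfies φ' = -xφ; integrability of fφ, f'φ and xfφ removes the boundary terms.
  have := integral_mul_deriv_eq_deriv_mul_of_integrable (u := f) (u' := f')
    (v := gaussianPDFReal 0 1) (v' := fun x => -(x * gaussianPDFReal 0 1 x))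
    (fun x _ => hf x) (fun x _ => hasDerivAt_gaussianPDFReal x)
    (h3.neg.congr (ae_of_all _ fun x => by simp; ring))
    (h2.congr (ae_of_all _ fun x => by simp; ring))
    (h1.congr (ae_of_all _ fun x => by simp; ring))
  simp only [smul_eq_mul]
  calc ∫ x, gaussianPDFReal 0 1 x * (x * f x)
      = -∫ x, f x * -(x * gaussianPDFReal 0 1 x) := by
        rw [← integral_neg]; congr 1; ext x; ring
    _ = ∫ x, gaussianPDFReal 0 1 x * f' x := by
        rw [this, neg_neg]; congr 1; ext x; ring

/-- Resampling one coordinate preserves a product of copies of a probability measure. -/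
lemma measurePreserving_update_pi {ι α : Type*} [Fintype ι] [DecidableEq ι] [MeasurableSpace α]
    (μ : Measure α) [IsProbabilityMeasure μ] (i : ι) :
    MeasurePreserving (fun p : (ι → α) × α => Function.update p.1 i p.2)
      ((Measure.pi fun _ : ι => μ).prod μ) (Measure.pi fun _ : ι => μ) := by
  have hm : Measurable (fun p : (ι → α) × α => Function.update p.1 i p.2) := by
    refine measurable_pi_iff.2 fun j => ?_
    by_cases h : j = i
    · subst h; simpa using measurable_snd
    · simp only [Function.update_of_ne h]; fun_prop
  refine ⟨hm, (Measure.pi_eq fun s hs => ?_).symm⟩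
  rw [Measure.map_apply hm (MeasurableSet.univ_pi hs)]
  have : (fun p : (ι → α) × α => Function.update p.1 i p.2) ⁻¹' (Set.univ.pi s) =
      (Set.univ.pi (Function.update s i Set.univ)) ×ˢ s i := by
    ext ⟨y, t⟩
    simp only [Set.mem_preimage, Set.mem_pi, Set.mem_univ, true_imp_iff, Set.mem_prod]
    constructor
    · intro h
      refine ⟨fun j => ?_, by simpa using h i⟩
      by_cases hj : j = i
      · subst hj; simp
      · simpa [Function.update_of_ne hj] using h j
    · rintro ⟨h, ht⟩ j
      by_cases hj : j = i
      · subst hj; simpa using ht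
      · simpa [Function.update_of_ne hj] using h j
  rw [this, Measure.prod_prod, Measure.pi_pi, ← Finset.mul_prod_erase _ _ (Finset.mem_univ i),
    ← Finset.mul_prod_erase _ (fun j => μ (s j)) (Finset.mem_univ i)]
  simp only [Function.update_self, measure_univ, one_mul]
  rw [mul_comm]
  congr 1
  refine Finset.prod_congr rfl fun j hj => ?_
  rw [Function.update_of_ne (Finset.ne_of_mem_erase hj)]

/-- Stein's identity in one coordinate of a standard Gaussian vector, for bounded functions. -/
lemma integral_pi_mul_eq_integral_deriv {ι : Type*} [Fintype ι] [DecidableEq ι] (i : ι)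
    {f f' : (ι → ℝ) → ℝ}
    (hd : ∀ x, HasDerivAt (fun t => f (Function.update x i t)) (f' x) (x i))
    (hf : Measurable f) (hf' : Measurable f') {C C' : ℝ} (hC : ∀ x, |f x| ≤ C)
    (hC' : ∀ x, |f' x| ≤ C') :
    Integrable (fun x => x i * f x) (Measure.pi fun _ : ι => gaussianReal 0 1) ∧
    ∫ x, x i * f x ∂(Measure.pi fun _ : ι => gaussianReal 0 1) =
      ∫ x, f' x ∂(Measure.pi fun _ : ι => gaussianReal 0 1) := by
  set γ := gaussianReal 0 1
  have hid : Integrable (fun x : ℝ => x) γ := IsGaussian.integrable_id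
  have hxi : Integrable (fun x : ι → ℝ => x i) (Measure.pi fun _ : ι => γ) :=
    integrable_comp_eval (μ := fun _ : ι => γ) (i := i) (f := fun x : ℝ => x) hid
  have hxf : Integrable (fun x => x i * f x) (Measure.pi fun _ : ι => γ) :=
    hxi.mul_bdd (c := C) hf.aestronglyMeasurable (ae_of_all _ hC)
  have hf'i : Integrable f' (Measure.pi fun _ : ι => γ) :=
    .of_bound hf'.aestronglyMeasurable C' (ae_of_all _ hC')
  refine ⟨hxf, ?_⟩
  -- Redrawing coordinate i leaves the law unchanged, so by Fubini the one-dimensional identity can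
  -- be used in the redrawn variable with the rest frozen.
  have hmp := measurePreserving_update_pi (ι := ι) γ i
  have e1 : ∀ h : (ι → ℝ) → ℝ, Measurable h → ∫ x, h x ∂(Measure.pi fun _ : ι => γ) =
      ∫ p, h (Function.update p.1 i p.2) ∂((Measure.pi fun _ : ι => γ).prod γ) := fun h hh => by
    rw [← hmp.map_eq, integral_map hmp.measurable.aemeasurable hh.aestronglyMeasurable, hmp.map_eq]
  rw [e1 _ (by fun_prop), e1 _ hf', integral_prod, integral_prod]
  · refine integral_congr_ae (ae_of_all _ fun y => ?_)
    have hmu : Measurable (fun t : ℝ => Function.update y i t) := measurable_update y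
    simp only [Function.update_self]
    have hfy : Measurable (fun t => f (Function.update y i t)) := hf.comp hmu
    refine integral_mul_gaussianReal_eq_integral_deriv (f := fun t => f (Function.update y i t))
      (f' := fun t => f' (Function.update y i t)) (fun t => ?_) ?_ ?_ ?_
    · simpa using hd (Function.update y i t)
    · exact .of_bound hfy.aestronglyMeasurable C (ae_of_all _ fun _ => hC _)
    · exact .of_bound (hf'.comp hmu).aestronglyMeasurable C' (ae_of_all _ fun _ => hC' _)
    · exact hid.mul_bdd (c := C) hfy.aestronglyMeasurable (ae_of_all _ fun _ => hC _)
  · exact hmp.integrable_comp_of_integrable hf'i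
  · exact hmp.integrable_comp_of_integrable hxf

end Stein

/-! ### Measurability of matrix inverses. -/

section Measurability

variable {n : Type*} [Fintype n] [DecidableEq n]

/-- Inversion is discontinuous at singular matrices, but det⁻¹ times the adjugate is measurable
everywhere. -/
lemma measurable_inv_entry (a b : n) : Measurable fun M : n → n → ℝ => (Matrix.of M)⁻¹ a b := by
  have hof : Continuous fun M : n → n → ℝ => Matrix.of M := continuous_id
  have h1 : Measurable fun M : n → n → ℝ => (Matrix.of M).det := hof.matrix_det.measurable
  have h2 : Measurable fun M : n → n → ℝ => (Matrix.of M).adjugate a b :=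
    (hof.matrix_adjugate.matrix_elem a b).measurable
  simp only [Matrix.inv_def, Ring.inverse_eq_inv', Matrix.smul_apply, smul_eq_mul]
  exact h1.inv.mul h2

lemma measurable_matrix_inv_apply {α : Type*} [MeasurableSpace α] {M : α → Matrix n n ℝ}
    (hM : ∀ a b, Measurable fun x => M x a b) (a b : n) : Measurable fun x => (M x)⁻¹ a b :=
  (measurable_inv_entry a b).comp
    (measurable_pi_iff.2 fun a => measurable_pi_iff.2 fun b => hM a b)

lemma measurable_matrix_det {α : Type*} [MeasurableSpace α] {M : α → Matrix n n ℝ}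
    (hM : ∀ a b, Measurable fun x => M x a b) : Measurable fun x => (M x).det := by
  have h1 : Measurable fun M : n → n → ℝ => (Matrix.of M).det :=
    (continuous_id (X := n → n → ℝ)).matrix_det.measurable
  exact h1.comp (measurable_pi_iff.2 fun a => measurable_pi_iff.2 fun b => hM a b)

end Measurability

/-! ### Stein's identity bounds the mean trace of the regularised inverse. -/

section InverseWishart

variable {ι n : Type*} [Fintype ι] [Fintype n] [DecidableEq n]

omit [Fintype n] in
lemma ridge_apply (δ : ℝ) (z : ι → n → ℝ) (a b : n) :
    ridge δ z a b = δ * (1 : Matrix n n ℝ) a b + ∑ i, z i a * z i b := by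
  simp [ridge, sumOuter_apply]

lemma trace_inv_ridge_nonneg {δ : ℝ} (hδ : 0 < δ) (z : ι → n → ℝ) :
    0 ≤ ((ridge δ z)⁻¹).trace := (posDef_ridge hδ z).inv.posSemidef.trace_nonneg

lemma trace_inv_ridge_le {δ : ℝ} (hδ : 0 < δ) (z : ι → n → ℝ) :
    ((ridge δ z)⁻¹).trace ≤ Fintype.card n * δ⁻¹ := by
  rw [Matrix.trace]
  refine (Finset.sum_le_sum fun a _ => inv_ridge_diag_le hδ z a).trans ?_
  simp

/-- With z the i-th vector, e = e_a and R = (ridge)⁻¹, moving the coordinate (i, a) changes the Gram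
matrix at rate ezᵀ + zeᵀ. The product rule for Rz gives Re - R(ezᵀ + zeᵀ)Rz, read at a. -/
lemma hasDerivAt_inv_ridge_mulVec [DecidableEq ι] {δ : ℝ} (hδ : 0 < δ) (x : ι × n → ℝ) (i : ι)
    (a : n) :
    HasDerivAt (fun t => ((ridge δ (Function.curry (Function.update x (i, a) t)))⁻¹ *ᵥ
        Function.curry (Function.update x (i, a) t) i) a)
      ((ridge δ (Function.curry x))⁻¹ a a -
        (ridge δ (Function.curry x))⁻¹ a a *
          (Function.curry x i ⬝ᵥ ((ridge δ (Function.curry x))⁻¹ *ᵥ Function.curry x i)) -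
        ((ridge δ (Function.curry x))⁻¹ *ᵥ Function.curry x i) a ^ 2) (x (i, a)) := by
  have hx : ∀ (j : ι) (b : n), HasDerivAt (fun t => Function.update x (i, a) t (j, b))
      (if j = i ∧ b = a then 1 else 0) (x (i, a)) := by
    intro j b
    by_cases h : j = i ∧ b = a
    · obtain ⟨rfl, rfl⟩ := h
      simpa using hasDerivAt_id' _
    · rw [if_neg h]
      have : (fun t => Function.update x (i, a) t (j, b)) = fun _ => x (j, b) := by
        ext t; rw [Function.update_of_ne]; simpa [Prod.ext_iff] using h
      rw [this]; exact hasDerivAt_const _ _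
  set M : ℝ → Matrix n n ℝ := fun t => ridge δ (Function.curry (Function.update x (i, a) t))
    with hMdef
  set z := Function.curry x i with hz
  set e : n → ℝ := Pi.single a 1 with he
  have hM : ∀ b c, HasDerivAt (fun t => M t b c) ((vecMulVec e z + vecMulVec z e) b c)
      (x (i, a)) := by
    intro b c
    simp only [hMdef, ridge_apply, Function.curry_apply]
    have h1 := HasDerivAt.fun_sum (u := Finset.univ) fun j _ => (hx j b).mul (hx j c)
    have h2 := h1.const_add (δ * (1 : Matrix n n ℝ) b c)
    convert! h2 using 1
    simp only [Function.update_eq_self, Matrix.add_apply, vecMulVec_apply, he, hz,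
      Function.curry_apply, Finset.sum_add_distrib]
    congr 1
    · rw [Finset.sum_eq_single i (fun j _ hj => by simp [hj]) (by simp)]
      by_cases hb : b = a
      · subst hb; simp
      · simp [hb]
    · rw [Finset.sum_eq_single i (fun j _ hj => by simp [hj]) (by simp)]
      by_cases hb : c = a
      · subst hb; simp
      · simp [hb]
  have hR := hasDerivAt_matrix_inv hM (fun s => isUnit_det_ridge hδ _)
  have hMx : M (x (i, a)) = ridge δ (Function.curry x) := by simp [hMdef]
  have hmain := HasDerivAt.fun_sum (u := Finset.univ) fun b _ => (hR a b).mul (hx i b)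
  rw [hMx] at hmain
  convert! hmain using 1
  set R := (ridge δ (Function.curry x))⁻¹ with hRdef
  simp only [Function.update_eq_self, Finset.sum_add_distrib, true_and]
  have e1 : ∑ b, R a b * (if b = a then (1 : ℝ) else 0) = R a a := by simp
  have e2 : ∑ b, -(R * (vecMulVec e z + vecMulVec z e) * R) a b * x (i, b) =
      -((R *ᵥ ((vecMulVec e z + vecMulVec z e) *ᵥ (R *ᵥ z))) a) := by
    rw [mulVec_mulVec, mulVec_mulVec]
    simp only [mulVec, dotProduct, neg_mul, Finset.sum_neg_distrib]
    rfl
  have e3 : e ⬝ᵥ (R *ᵥ z) = (R *ᵥ z) a := by simp [he]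
  have e4 : (R *ᵥ e) a = R a a := by simp [he]
  rw [e1, e2, add_mulVec, vecMulVec_mulVec, vecMulVec_mulVec, mulVec_add]
  simp only [op_smul_eq_smul, mulVec_smul, Pi.add_apply, Pi.smul_apply, smul_eq_mul, e3, e4]
  ring

/-- The law of `card ι` independent standard Gaussian vectors indexed by `n`. -/
noncomputable abbrev stdNormal (ι : Type*) [Fintype ι] : Measure (ι → ℝ) :=
  Measure.pi fun _ : ι => gaussianReal 0 1

lemma measurable_inv_ridge (δ : ℝ) (a b : n) :
    Measurable fun x : ι × n → ℝ => (ridge δ (Function.curry x))⁻¹ a b :=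
  measurable_matrix_inv_apply (fun a b => by
    simp only [ridge_apply, Function.curry_apply]; fun_prop) a b

lemma measurable_trace_inv_ridge (δ : ℝ) :
    Measurable fun x : ι × n → ℝ => ((ridge δ (Function.curry x))⁻¹).trace := by
  simp only [Matrix.trace, Matrix.diag]
  exact Finset.measurable_sum _ fun a _ => measurable_inv_ridge δ a a

lemma integrable_trace_inv_ridge {δ : ℝ} (hδ : 0 < δ) :
    Integrable (fun x : ι × n → ℝ => ((ridge δ (Function.curry x))⁻¹).trace)
      (stdNormal (ι × n)) :=
  .of_bound (measurable_trace_inv_ridge δ).aestronglyMeasurable (Fintype.card n * δ⁻¹)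
    (ae_of_all _ fun x => by
      rw [Real.norm_of_nonneg (trace_inv_ridge_nonneg hδ _)]; exact trace_inv_ridge_le hδ _)

/-- Apply Stein's identity to f_(i,a) = (R z_i)_a and sum over (i, a). The left side is the mean of
Σ z_iᵀRz_i = n - δ tr R ≤ n. The divergence is N tr R - (n - δ tr R) tr R - Σ‖Rz_i‖², which is at
least (N - n - 1) tr R. Here N and n are the cardinalities of `ι` and `n`. -/
lemma integral_trace_inv_ridge_le {δ : ℝ} (hδ : 0 < δ) :
    ((Fintype.card ι : ℝ) - Fintype.card n - 1) *
      ∫ x : ι × n → ℝ, ((ridge δ (Function.curry x))⁻¹).trace ∂(stdNormal (ι × n)) ≤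
      Fintype.card n := by
  classical
  set R : (ι × n → ℝ) → Matrix n n ℝ := fun x => (ridge δ (Function.curry x))⁻¹ with hR
  set f : ι × n → (ι × n → ℝ) → ℝ := fun p x => (R x *ᵥ Function.curry x p.1) p.2 with hf
  set f' : ι × n → (ι × n → ℝ) → ℝ := fun p x => R x p.2 p.2 -
    R x p.2 p.2 * (Function.curry x p.1 ⬝ᵥ (R x *ᵥ Function.curry x p.1)) - f p x ^ 2 with hf'
  have hRm : ∀ a b, Measurable fun x => R x a b := fun a b => measurable_inv_ridge δ a b
  have hfm : ∀ p, Measurable (f p) := fun p => by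
    simp only [hf, mulVec, dotProduct, Function.curry_apply]
    fun_prop
  have hfm' : ∀ p, Measurable (f' p) := fun p => by
    refine ((hRm _ _).sub ((hRm _ _).mul ?_)).sub ((hfm p).pow_const 2)
    simp only [mulVec, dotProduct, Function.curry_apply]
    fun_prop
  have hfb : ∀ p x, |f p x| ≤ √δ⁻¹ := fun p x =>
    Real.abs_le_sqrt (inv_ridge_mulVec_sq_le hδ _ _ _)
  -- Each of the three terms of `f'` lies in [0, δ⁻¹] up to its sign, and two of them are
  -- subtracted.
  have hfb' : ∀ p x, |f' p x| ≤ 2 * δ⁻¹ := fun p x => by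
    have h1 := inv_ridge_diag_nonneg hδ (Function.curry x) p.2
    have h2 := inv_ridge_diag_le hδ (Function.curry x) p.2
    have h3 := inv_ridge_quadratic_nonneg hδ (Function.curry x) (Function.curry x p.1)
    have h4 := inv_ridge_quadratic_le_one hδ (Function.curry x) p.1
    have h5 := inv_ridge_mulVec_sq_le hδ (Function.curry x) p.1 p.2
    have h6 := sq_nonneg (f p x)
    simp only [hf', hf, hR] at *
    rw [abs_le]
    constructor <;> nlinarith [mul_le_mul h2 h4 h3 (h1.trans h2), mul_nonneg h1 h3]
  have hst := fun p : ι × n => integral_pi_mul_eq_integral_deriv p (f := f p) (f' := f' p)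
    (fun x => hasDerivAt_inv_ridge_mulVec hδ x p.1 p.2) (hfm p) (hfm' p) (hfb p) (hfb' p)
  have hint' : ∀ p, Integrable (f' p) (stdNormal (ι × n)) := fun p =>
    .of_bound (hfm' p).aestronglyMeasurable _ (ae_of_all _ (hfb' p))
  have hT := integrable_trace_inv_ridge (ι := ι) (n := n) hδ
  have key : ∫ x, ∑ p, x p * f p x ∂(stdNormal (ι × n)) =
      ∫ x, ∑ p, f' p x ∂(stdNormal (ι × n)) := by
    rw [integral_finsetSum _ fun p _ => (hst p).1, integral_finsetSum _ fun p _ => hint' p]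
    exact Finset.sum_congr rfl fun p _ => (hst p).2
  have hq : ∀ x : ι × n → ℝ, ∑ i, Function.curry x i ⬝ᵥ (R x *ᵥ Function.curry x i) =
      Fintype.card n - δ * (R x).trace := fun x => sum_inv_ridge_quadratic hδ _
  have h1 : ∀ x : ι × n → ℝ, ∑ p, x p * f p x ≤ Fintype.card n := fun x => by
    have := mul_nonneg hδ.le (trace_inv_ridge_nonneg hδ (Function.curry x))
    rw [Fintype.sum_prod_type]
    refine (le_of_eq (hq x)).trans ?_
    linarith
  have h2 : ∀ x : ι × n → ℝ, ((Fintype.card ι : ℝ) - Fintype.card n - 1) * (R x).trace ≤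
      ∑ p, f' p x := fun x => by
    have hT0 := trace_inv_ridge_nonneg hδ (Function.curry x)
    have hs := sum_inv_ridge_normSq_le hδ (Function.curry x)
    have e : ∑ p, f' p x = Fintype.card ι * (R x).trace -
        (R x).trace * (Fintype.card n - δ * (R x).trace) - ∑ i, ∑ a, f (i, a) x ^ 2 := by
      simp only [hf', Finset.sum_sub_distrib, Fintype.sum_prod_type]
      congr 2
      · simp [Matrix.trace]
      · rw [← hq, Finset.mul_sum]
        exact Finset.sum_congr rfl fun i _ => by rw [← Finset.sum_mul]; rfl
    rw [e]
    have : 0 ≤ δ * ((R x).trace * (R x).trace) := mul_nonneg hδ.le (mul_self_nonneg _)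
    simp only [hf, hR] at *
    nlinarith
  calc _ = ∫ x, ((Fintype.card ι : ℝ) - Fintype.card n - 1) * (R x).trace
        ∂(stdNormal (ι × n)) := (integral_const_mul _ _).symm
    _ ≤ ∫ x, ∑ p, f' p x ∂(stdNormal (ι × n)) :=
        integral_mono (hT.const_mul _) (integrable_finsetSum _ fun p _ => hint' p) h2
    _ = ∫ x, ∑ p, x p * f p x ∂(stdNormal (ι × n)) := key.symm
    _ ≤ ∫ _, (Fintype.card n : ℝ) ∂(stdNormal (ι × n)) :=
        integral_mono (integrable_finsetSum _ fun p _ => (hst p).1) (integrable_const _) h1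
    _ = Fintype.card n := by simp

end InverseWishart

/-! ### Removing the regularisation: almost sure invertibility and integrable inverse. -/

section InverseWishartLimit

variable {ι n : Type*} [Fintype ι] [Fintype n] [DecidableEq n]

/-- A null vector v of the Gram matrix satisfies Rv = δ⁻¹v. Cauchy–Schwarz bounds ‖Rv‖² by ‖R‖²‖v‖²
in Frobenius norm, and δ‖R‖² ≤ tr R. -/
lemma inv_le_trace_inv_ridge {δ : ℝ} (hδ : 0 < δ) (z : ι → n → ℝ) (h : (sumOuter z).det = 0) :
    δ⁻¹ ≤ ((ridge δ z)⁻¹).trace := by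
  obtain ⟨v, hv0, hv⟩ := exists_mulVec_eq_zero_iff.2 h
  set R := (ridge δ z)⁻¹ with hR
  have hRv : R *ᵥ v = δ⁻¹ • v := by
    have h1 : ridge δ z *ᵥ v = δ • v := by rw [ridge, add_mulVec, hv, smul_mulVec, one_mulVec, add_zero]
    have h2 : R *ᵥ (ridge δ z *ᵥ v) = v := by
      rw [mulVec_mulVec, hR, inv_ridge_mul hδ, one_mulVec]
    rw [h1, mulVec_smul] at h2
    rw [← h2, smul_smul, inv_mul_cancel₀ hδ.ne', one_smul, h2]
  have hsymm : ∀ a b, R a b = R b a := fun a b => by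
    simpa using (posDef_ridge hδ z).inv.1.apply b a
  have hvv : 0 < v ⬝ᵥ v := (dotProduct_self_nonneg' v).lt_of_ne fun h0 =>
    hv0 (dotProduct_self_eq_zero.1 h0.symm)
  have hcs : (R *ᵥ v) ⬝ᵥ (R *ᵥ v) ≤ (∑ a, R.col a ⬝ᵥ R.col a) * (v ⬝ᵥ v) := by
    rw [Finset.sum_mul]
    refine Finset.sum_le_sum fun a _ => ?_
    have := Finset.sum_mul_sq_le_sq_mul_sq Finset.univ (fun b => R a b) v
    simp only [mulVec, dotProduct, Matrix.col_apply] at *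
    simpa [sq, hsymm _ a] using this
  have htr : δ * ∑ a, R.col a ⬝ᵥ R.col a ≤ R.trace := by
    rw [Finset.mul_sum, Matrix.trace]
    refine Finset.sum_le_sum fun a _ => ?_
    have h := dotProduct_inv_ridge_mulVec_self hδ z (Pi.single a 1)
    simp only [mulVec_single_one, single_one_dotProduct, Matrix.col_apply] at h
    rw [Matrix.diag_apply, hR, h]
    exact le_add_of_nonneg_right (Finset.sum_nonneg fun i _ => sq_nonneg _)
  rw [hRv, smul_dotProduct, dotProduct_smul, smul_eq_mul, smul_eq_mul, ← mul_assoc] at hcs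
  have h3 := le_of_mul_le_mul_right hcs hvv
  have h4 := mul_le_mul_of_nonneg_left h3 hδ.le
  rw [← mul_assoc, mul_inv_cancel₀ hδ.ne', one_mul] at h4
  exact h4.trans htr

omit [Fintype n] [DecidableEq n] in
lemma measurable_sumOuter (a b : n) :
    Measurable fun x : ι × n → ℝ => sumOuter (Function.curry x) a b := by
  simp only [sumOuter_apply, Function.curry_apply]; fun_prop

variable (hN : Fintype.card n + 1 < Fintype.card ι)
include hN

lemma integral_trace_inv_ridge_le_div {δ : ℝ} (hδ : 0 < δ) :
    ∫ x : ι × n → ℝ, ((ridge δ (Function.curry x))⁻¹).trace ∂(stdNormal (ι × n)) ≤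
      Fintype.card n / ((Fintype.card ι : ℝ) - Fintype.card n - 1) := by
  have h0 : (0 : ℝ) < (Fintype.card ι : ℝ) - Fintype.card n - 1 := by
    have : ((Fintype.card n + 1 : ℕ) : ℝ) < Fintype.card ι := by exact_mod_cast hN
    push_cast at this; linarith
  rw [le_div_iff₀ h0, mul_comm]
  exact integral_trace_inv_ridge_le hδ

/-- The Gram matrix of more than `card n + 1` standard Gaussian vectors is invertible a.s. -/
lemma ae_det_sumOuter_ne_zero :
    ∀ᵐ x ∂(stdNormal (ι × n)), (sumOuter (Function.curry x)).det ≠ 0 := by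
  set μ := stdNormal (ι × n)
  set s := {x : ι × n → ℝ | (sumOuter (Function.curry x)).det = 0} with hs
  set c := Fintype.card n / ((Fintype.card ι : ℝ) - Fintype.card n - 1)
  have hsm : MeasurableSet s := (measurable_matrix_det measurable_sumOuter) (measurableSet_singleton 0)
  -- Markov's inequality: the trace is at least δ⁻¹ on the singular set, while its mean is at most
  -- `c` for every δ.
  have h : ∀ δ : ℝ, 0 < δ → μ.real s ≤ δ * c := fun δ hδ => by
    have h1 : μ.real s * δ⁻¹ ≤ c := by
      refine le_trans ?_ (integral_trace_inv_ridge_le_div hN hδ)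
      rw [← smul_eq_mul, ← integral_indicator_const _ hsm]
      refine integral_mono ((integrable_const _).indicator hsm) (integrable_trace_inv_ridge hδ) ?_
      intro x
      by_cases hx : x ∈ s
      · simpa [hx] using inv_le_trace_inv_ridge hδ _ hx
      · simpa [hx] using trace_inv_ridge_nonneg hδ _
    rw [← div_eq_mul_inv, div_le_iff₀ hδ] at h1
    linarith
  have h0 : μ.real s ≤ 0 := by
    have ht : Tendsto (fun δ : ℝ => δ * c) (𝓝[>] 0) (𝓝 0) := by
      have : Tendsto (fun δ : ℝ => δ * c) (𝓝 0) (𝓝 (0 * c)) := tendsto_id.mul_const c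
      rw [zero_mul] at this
      exact this.mono_left inf_le_left
    exact ge_of_tendsto ht (by filter_upwards [self_mem_nhdsWithin] with δ hδ using h δ hδ)
  have h1 : μ s = 0 := by
    have := le_antisymm h0 measureReal_nonneg
    simpa [measureReal_eq_zero_iff] using this
  exact measure_eq_zero_iff_ae_notMem.1 h1

omit hN in
lemma trace_inv_sumOuter_nonneg (z : ι → n → ℝ) : 0 ≤ ((sumOuter z)⁻¹).trace :=
  (posSemidef_sumOuter z).inv.trace_nonneg

/-- Fatou's lemma along δ = 1/(k+1), the bound on the means being uniform in δ. -/
lemma lintegral_trace_inv_sumOuter_le :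
    ∫⁻ x, ENNReal.ofReal ((sumOuter (Function.curry x))⁻¹).trace ∂(stdNormal (ι × n)) ≤
      ENNReal.ofReal (Fintype.card n / ((Fintype.card ι : ℝ) - Fintype.card n - 1)) := by
  have hδ : ∀ k : ℕ, (0 : ℝ) < 1 / ((k : ℝ) + 1) := fun k => by positivity
  have hlim : ∀ᵐ x ∂(stdNormal (ι × n)), Tendsto
      (fun k : ℕ => ENNReal.ofReal ((ridge (1 / ((k : ℝ) + 1)) (Function.curry x))⁻¹).trace) atTop
      (𝓝 (ENNReal.ofReal ((sumOuter (Function.curry x))⁻¹).trace)) := by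
    filter_upwards [ae_det_sumOuter_ne_zero hN] with x hx
    refine ENNReal.tendsto_ofReal ?_
    have h1 : Tendsto (fun k : ℕ => ridge (1 / ((k : ℝ) + 1)) (Function.curry x)) atTop
        (𝓝 (sumOuter (Function.curry x))) := by
      have := (tendsto_one_div_add_atTop_nhds_zero_nat (𝕜 := ℝ)).smul_const (1 : Matrix n n ℝ)
      simpa [ridge] using this.add_const (sumOuter (Function.curry x))
    have h2 : ContinuousAt (fun A : Matrix n n ℝ => A⁻¹) (sumOuter (Function.curry x)) := by
      refine continuousAt_matrix_inv _ ?_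
      rw [Ring.inverse_eq_inv']
      exact continuousAt_inv₀ hx
    exact ((continuous_id.matrix_trace).tendsto _).comp (h2.tendsto.comp h1)
  calc _ = ∫⁻ x, liminf (fun k : ℕ =>
        ENNReal.ofReal ((ridge (1 / ((k : ℝ) + 1)) (Function.curry x))⁻¹).trace) atTop
          ∂(stdNormal (ι × n)) :=
        lintegral_congr_ae (by filter_upwards [hlim] with x hx using hx.liminf_eq.symm)
    _ ≤ liminf (fun k : ℕ => ∫⁻ x,
        ENNReal.ofReal ((ridge (1 / ((k : ℝ) + 1)) (Function.curry x))⁻¹).trace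
          ∂(stdNormal (ι × n))) atTop :=
        lintegral_liminf_le fun k => (measurable_trace_inv_ridge _).ennreal_ofReal
    _ ≤ _ := by
        refine liminf_le_of_frequently_le' (Frequently.of_forall fun k => ?_)
        rw [← ofReal_integral_eq_lintegral_ofReal (integrable_trace_inv_ridge (hδ k))
          (ae_of_all _ fun x => trace_inv_ridge_nonneg (hδ k) _)]
        exact ENNReal.ofReal_le_ofReal (integral_trace_inv_ridge_le_div hN (hδ k))

/-- An inverse Wishart matrix has an integrable trace, with the expected bound on its mean. -/
lemma integrable_trace_inv_sumOuter :
    Integrable (fun x => ((sumOuter (Function.curry x))⁻¹).trace) (stdNormal (ι × n)) ∧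
    ∫ x, ((sumOuter (Function.curry x))⁻¹).trace ∂(stdNormal (ι × n)) ≤
      Fintype.card n / ((Fintype.card ι : ℝ) - Fintype.card n - 1) := by
  have hm : Measurable fun x : ι × n → ℝ => ((sumOuter (Function.curry x))⁻¹).trace := by
    simp only [Matrix.trace, Matrix.diag]
    exact Finset.measurable_sum _ fun a _ => measurable_matrix_inv_apply measurable_sumOuter a a
  have h0 : (0 : ℝ) ≤ Fintype.card n / ((Fintype.card ι : ℝ) - Fintype.card n - 1) := by
    have : ((Fintype.card n + 1 : ℕ) : ℝ) < Fintype.card ι := by exact_mod_cast hN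
    push_cast at this
    exact div_nonneg (Nat.cast_nonneg _) (by linarith)
  have hle := lintegral_trace_inv_sumOuter_le hN
  have hint : Integrable (fun x => ((sumOuter (Function.curry x))⁻¹).trace) (stdNormal (ι × n)) := by
    refine ⟨hm.aestronglyMeasurable, ?_⟩
    rw [hasFiniteIntegral_iff_ofReal (ae_of_all _ fun x => trace_inv_sumOuter_nonneg _)]
    exact hle.trans_lt ENNReal.ofReal_lt_top
  refine ⟨hint, ?_⟩
  rw [← ofReal_integral_eq_lintegral_ofReal hint
    (ae_of_all _ fun x => trace_inv_sumOuter_nonneg _)] at hle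
  exact (ENNReal.ofReal_le_ofReal_iff h0).1 hle

end InverseWishartLimit

/-! ### Tools for passing to the limit in means and in matrix inverses. -/

section Convergence

/-- Testing positivity on e_a ± e_b gives 2|M a b| ≤ M a a + M b b. -/
lemma abs_apply_le_trace {n : Type*} [Fintype n] [DecidableEq n] {M : Matrix n n ℝ}
    (hM : M.PosSemidef) (a b : n) : |M a b| ≤ M.trace := by
  have hs : M b a = M a b := by simpa using hM.1.apply a b
  have hq : ∀ s : ℝ, 0 ≤ M a a + 2 * s * M a b + s ^ 2 * M b b := fun s => by
    have := hM.dotProduct_mulVec_nonneg (Pi.single a 1 + s • Pi.single b 1)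
    simp only [star_trivial, mulVec_add, mulVec_smul, mulVec_single_one, add_dotProduct,
      dotProduct_add, smul_dotProduct, dotProduct_smul, single_one_dotProduct, Matrix.col_apply,
      smul_eq_mul, hs] at this
    linarith
  have hle : ∀ c, M c c ≤ M.trace := fun c =>
    Finset.single_le_sum (f := fun c => M c c) (fun c _ => hM.diag_nonneg) (Finset.mem_univ c)
  have h1 := hq 1
  have h2 := hq (-1)
  rw [abs_le]
  constructor <;> linarith [hle a, hle b]

/-- A version of dominated convergence with convergent dominating integrals. -/
lemma tendsto_integral_of_abs_le_of_tendsto {Ω : Type*} [MeasurableSpace Ω] {P : Measure Ω}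
    [IsProbabilityMeasure P] {f h : ℕ → Ω → ℝ} {ℓ c : ℝ} {C : ℕ → ℝ}
    (hfm : ∀ N, AEStronglyMeasurable (f N) P) (hhm : ∀ N, AEStronglyMeasurable (h N) P)
    (hint : ∀ᶠ N in atTop, Integrable (h N) P) (hfh : ∀ N ω, |f N ω| ≤ h N ω)
    (hf : ∀ᵐ ω ∂P, Tendsto (fun N => f N ω) atTop (𝓝 ℓ))
    (hh : ∀ᵐ ω ∂P, Tendsto (fun N => h N ω) atTop (𝓝 c))
    (hC : ∀ᶠ N in atTop, ∫ ω, h N ω ∂P ≤ C N) (hCc : Tendsto C atTop (𝓝 c)) :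
    Tendsto (fun N => ∫ ω, f N ω ∂P) atTop (𝓝 ℓ) := by
  -- The functions h ± f are nonnegative, so truncation at K makes dominated convergence available;
  -- K is large enough not to alter the limits c ± ℓ. Truncation only lowers the integrals, so
  -- together with ∫h ≤ C → c the two signs squeeze ∫f.
  have aux : ∀ s : ℝ, |s| = 1 → ∀ K : ℝ, c + s * ℓ ≤ K → 0 ≤ K →
      Tendsto (fun N => ∫ ω, min (h N ω + s * f N ω) K ∂P) atTop (𝓝 (c + s * ℓ)) := by
    intro s hs K hK hK0
    have := tendsto_integral_of_dominated_convergence (μ := P)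
      (F := fun N ω => min (h N ω + s * f N ω) K) (f := fun _ => min (c + s * ℓ) K) (fun _ => K)
      (fun N => ((hhm N).add ((hfm N).const_mul s)).inf aestronglyMeasurable_const)
      (integrable_const _) ?_ ?_
    · simpa [min_eq_left hK] using this
    · refine fun N => ae_of_all _ fun ω => ?_
      have h1 : |s * f N ω| ≤ h N ω := by rw [abs_mul, hs, one_mul]; exact hfh N ω
      rw [Real.norm_of_nonneg (le_min (by linarith [(abs_le.1 h1).1]) hK0)]
      exact min_le_right _ _
    · filter_upwards [hf, hh] with ω h1 h2
      exact (h2.add (h1.const_mul s)).min tendsto_const_nhds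
  set K := |c| + |ℓ| with hK
  have hK0 : 0 ≤ K := by positivity
  have l1 := aux 1 (by simp) K (by rw [hK]; linarith [le_abs_self c, le_abs_self ℓ]) hK0
  have l2 := aux (-1) (by simp) K (by rw [hK]; linarith [le_abs_self c, neg_abs_le ℓ]) hK0
  have t1 := l1.sub hCc
  have t2 := hCc.sub l2
  rw [show c + 1 * ℓ - c = ℓ by ring] at t1
  rw [show c - (c + -1 * ℓ) = ℓ by ring] at t2
  have hfi : ∀ᶠ N in atTop, Integrable (f N) P := by
    filter_upwards [hint] with N hN
    exact hN.mono' (hfm N) (ae_of_all _ fun ω => hfh N ω)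
  have hmin : ∀ᶠ N in atTop, ∀ s : ℝ, ∫ ω, min (h N ω + s * f N ω) K ∂P ≤
      ∫ ω, h N ω ∂P + s * ∫ ω, f N ω ∂P := by
    filter_upwards [hint, hfi] with N h1 h2 s
    rw [← integral_const_mul, ← integral_add h1 (h2.const_mul s)]
    have hi := h1.add (h2.const_mul s)
    exact integral_mono (hi.inf (integrable_const K)) hi fun ω => min_le_left _ _
  refine tendsto_of_tendsto_of_tendsto_of_le_of_le' t1 t2 ?_ ?_
  · filter_upwards [hmin, hC] with N h1 h2
    linarith [h1 1]
  · filter_upwards [hmin, hC] with N h1 h2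
    linarith [h1 (-1)]

lemma matrix_inv_smul {n : Type*} [Fintype n] [DecidableEq n] {k : ℝ} (hk : k ≠ 0)
    (M : Matrix n n ℝ) : (k • M)⁻¹ = k⁻¹ • M⁻¹ := by
  by_cases h : IsUnit M.det
  · exact Matrix.inv_smul' M (Units.mk0 k hk) h
  -- A singular matrix has inverse 0 by convention, so both sides vanish.
  · have h2 : ¬ IsUnit (k • M).det := by
      rw [Matrix.det_smul]
      simp only [isUnit_iff_ne_zero, ne_eq, mul_eq_zero, not_not] at h ⊢
      exact Or.inr h
    rw [nonsing_inv_apply_not_isUnit _ h, nonsing_inv_apply_not_isUnit _ h2, smul_zero]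

lemma tendsto_matrix_inv {n α : Type*} [Fintype n] [DecidableEq n] {l : Filter α}
    {M : α → Matrix n n ℝ} {M₀ : Matrix n n ℝ} (h : M₀.det ≠ 0) (hM : Tendsto M l (𝓝 M₀)) :
    Tendsto (fun x => (M x)⁻¹) l (𝓝 M₀⁻¹) := by
  refine (continuousAt_matrix_inv M₀ ?_).tendsto.comp hM
  rw [Ring.inverse_eq_inv']
  exact continuousAt_inv₀ h

end Convergence

/-! ### Strong law for averages and for Gram matrices of Gaussian samples. -/

section Samples

variable {Ω : Type*} [MeasurableSpace Ω] {P : Measure Ω} [IsProbabilityMeasure P]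

omit [IsProbabilityMeasure P] in
lemma ae_tendsto_average {E : Type*} [MeasurableSpace E] {U : ℕ → Ω → E} {μ : Measure E}
    (hU : iIndepFun U P) (hlaw : ∀ i, HasLaw (U i) μ P) {φ : E → ℝ} (hφ : Measurable φ)
    (hint : Integrable φ μ) :
    ∀ᵐ ω ∂P, Tendsto (fun N : ℕ => (N : ℝ)⁻¹ * ∑ i : Fin N, φ (U i ω)) atTop (𝓝 (∫ x, φ x ∂μ)) := by
  have h0 : Integrable (fun ω => φ (U 0 ω)) P := by
    have := (hlaw 0).map_eq ▸ hint
    exact this.comp_aemeasurable (hlaw 0).aemeasurable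
  have h := strong_law_ae (fun i ω => φ (U i ω)) h0
    (fun i j hij => (hU.indepFun hij).comp hφ hφ)
    (fun i => (IdentDistrib.mk (hlaw i).aemeasurable (hlaw 0).aemeasurable
      ((hlaw i).map_eq.trans (hlaw 0).map_eq.symm)).comp hφ)
  have e : ∫ ω, φ (U 0 ω) ∂P = ∫ x, φ x ∂μ := (hlaw 0).integral_comp hφ.aestronglyMeasurable
  rw [e] at h
  filter_upwards [h] with ω hω
  simpa [Finset.sum_range] using hω

variable {n : Type*} [Fintype n]

/-- The Gram matrix `∑ i < N, Y i (Y i)ᵀ` of the first `N` observations. -/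
def gram (Y : ℕ → Ω → EuclideanSpace ℝ n) (N : ℕ) (ω : Ω) : Matrix n n ℝ :=
  sumOuter fun (i : Fin N) a => Y i ω a

omit [MeasurableSpace Ω] [Fintype n] in
lemma gram_apply (Y : ℕ → Ω → EuclideanSpace ℝ n) (N : ℕ) (ω : Ω) (a b : n) :
    gram Y N ω a b = ∑ i : Fin N, Y i ω a * Y i ω b := rfl

omit [MeasurableSpace Ω] [Fintype n] in
lemma gram_eq_mul_transpose (Y : ℕ → Ω → EuclideanSpace ℝ n) (N : ℕ) (ω : Ω) :
    gram Y N ω = (Matrix.of fun a (i : Fin N) => Y i ω a) *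
      (Matrix.of fun a (i : Fin N) => Y i ω a)ᵀ := by
  ext a b; simp [gram_apply, Matrix.mul_apply]

variable [DecidableEq n] {Y : ℕ → Ω → EuclideanSpace ℝ n} {Γ : Matrix n n ℝ}

lemma integrable_mul_multivariateGaussian (a b : n) :
    Integrable (fun y : EuclideanSpace ℝ n => y a * y b) (multivariateGaussian 0 Γ) := by
  have h : ∀ a, MemLp (fun y : EuclideanSpace ℝ n => y a) 2 (multivariateGaussian 0 Γ) := fun a =>
    (EuclideanSpace.proj (𝕜 := ℝ) a).comp_memLp' IsGaussian.memLp_two_id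
  exact (h a).integrable_mul (h b)

lemma integral_eval_multivariateGaussian (a : n) :
    ∫ y : EuclideanSpace ℝ n, y a ∂(multivariateGaussian 0 Γ) = 0 := by
  have := (EuclideanSpace.proj (𝕜 := ℝ) a : EuclideanSpace ℝ n →L[ℝ] ℝ).integral_comp_comm
    (IsGaussian.integrable_id (μ := multivariateGaussian (0 : EuclideanSpace ℝ n) Γ))
  simpa using this

lemma integral_mul_multivariateGaussian (hΓ : Γ.PosSemidef) (a b : n) :
    ∫ y : EuclideanSpace ℝ n, y a * y b ∂(multivariateGaussian 0 Γ) = Γ a b := by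
  have h : ∀ a, MemLp (fun y : EuclideanSpace ℝ n => y a) 2 (multivariateGaussian 0 Γ) := fun a =>
    (EuclideanSpace.proj (𝕜 := ℝ) a).comp_memLp' IsGaussian.memLp_two_id
  have := covariance_eval_multivariateGaussian (μ := 0) hΓ a b
  rw [covariance_eq_sub (h a) (h b)] at this
  simpa [integral_eval_multivariateGaussian] using this

omit [IsProbabilityMeasure P] in
lemma ae_tendsto_gram (hΓ : Γ.PosSemidef) (hY : iIndepFun Y P)
    (hlaw : ∀ i, HasLaw (Y i) (multivariateGaussian 0 Γ) P) :
    ∀ᵐ ω ∂P, Tendsto (fun N : ℕ => (N : ℝ)⁻¹ • gram Y N ω) atTop (𝓝 Γ) := by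
  have h : ∀ a b, ∀ᵐ ω ∂P, Tendsto (fun N : ℕ => (N : ℝ)⁻¹ * ∑ i : Fin N, Y i ω a * Y i ω b) atTop
      (𝓝 (Γ a b)) := fun a b => by
    rw [← integral_mul_multivariateGaussian hΓ a b]
    exact ae_tendsto_average hY hlaw (φ := fun y => y a * y b) (by fun_prop)
      (integrable_mul_multivariateGaussian a b)
  filter_upwards [ae_all_iff.2 fun a => ae_all_iff.2 fun b => h a b] with ω hω
  exact tendsto_pi_nhds.2 fun a => tendsto_pi_nhds.2 fun b => hω a b

omit [IsProbabilityMeasure P] in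
lemma ae_tendsto_inv_gram (hΓ : Γ.PosDef) (hY : iIndepFun Y P)
    (hlaw : ∀ i, HasLaw (Y i) (multivariateGaussian 0 Γ) P) :
    ∀ᵐ ω ∂P, Tendsto (fun N : ℕ => (N : ℝ) • (gram Y N ω)⁻¹) atTop (𝓝 Γ⁻¹) := by
  filter_upwards [ae_tendsto_gram hΓ.posSemidef hY hlaw] with ω hω
  refine (tendsto_matrix_inv hΓ.det_pos.ne' hω).congr' ?_
  filter_upwards [eventually_ne_atTop 0] with N hN
  rw [matrix_inv_smul (inv_ne_zero (Nat.cast_ne_zero.2 hN)), inv_inv]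

omit [IsProbabilityMeasure P] in
lemma aemeasurable_inv_gram (hYm : ∀ i, AEMeasurable (Y i) P) (N : ℕ) (a b : n) :
    AEMeasurable (fun ω => (gram Y N ω)⁻¹ a b) P := by
  have h : AEMeasurable (fun ω a b => gram Y N ω a b) P := by
    refine aemeasurable_pi_lambda _ fun a => aemeasurable_pi_lambda _ fun b => ?_
    simp only [gram_apply]
    exact Finset.aemeasurable_fun_sum _ fun i _ => by fun_prop
  exact (measurable_inv_entry a b).comp_aemeasurable h

end Samples

/-! ### Inverse moments of the Gram matrix for standard Gaussian samples. -/

section StandardSamples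

variable {n : Type*} [Fintype n] [DecidableEq n]

/-- Passes from N independent Gaussian vectors to one product measure over all scalar coordinates,
the setting of the inverse Wishart bounds. -/
lemma measurePreserving_uncurry_stdGaussian (N : ℕ) :
    MeasurePreserving (fun (z : Fin N → EuclideanSpace ℝ n) (p : Fin N × n) => z p.1 p.2)
      (Measure.pi fun _ => multivariateGaussian 0 (1 : Matrix n n ℝ)) (stdNormal (Fin N × n)) := by
  have h1 : MeasurePreserving (fun z : EuclideanSpace ℝ n => WithLp.ofLp z)
      (multivariateGaussian 0 (1 : Matrix n n ℝ)) (stdNormal n) := by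
    refine ⟨by fun_prop, ?_⟩
    rw [multivariateGaussian_zero_one, ← map_pi_eq_stdGaussian, Measure.map_map (by fun_prop) (by fun_prop)]
    exact Measure.map_id
  have h2 := measurePreserving_pi (fun _ : Fin N => multivariateGaussian 0 (1 : Matrix n n ℝ))
    (fun _ => stdNormal n) (fun _ => h1)
  have h3 : MeasurePreserving (MeasurableEquiv.curry (Fin N) n ℝ).symm
      (Measure.pi fun _ : Fin N => stdNormal n) (stdNormal (Fin N × n)) := by
    refine ⟨(MeasurableEquiv.curry (Fin N) n ℝ).symm.measurable, ?_⟩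
    have := Measure.infinitePi_map_curry_symm (fun (_ : Fin N) (_ : n) => gaussianReal 0 1)
    simpa only [Measure.infinitePi_eq_pi] using this
  exact h3.comp h2

variable {Ω : Type*} [MeasurableSpace Ω] {P : Measure Ω} [IsProbabilityMeasure P]
  {Z : ℕ → Ω → EuclideanSpace ℝ n}

omit [IsProbabilityMeasure P] in
lemma hasLaw_uncurry_stdNormal (hZ : iIndepFun Z P)
    (hlaw : ∀ i, HasLaw (Z i) (multivariateGaussian 0 (1 : Matrix n n ℝ)) P) (N : ℕ) :
    HasLaw (fun ω (p : Fin N × n) => Z p.1 ω p.2) (stdNormal (Fin N × n)) P :=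
  (measurePreserving_uncurry_stdGaussian N).hasLaw.fun_comp
    ((hZ.precomp Fin.val_injective).hasLaw_pi fun i => hlaw i)

omit [IsProbabilityMeasure P] in
lemma ae_det_gram_ne_zero_of_std (hZ : iIndepFun Z P)
    (hlaw : ∀ i, HasLaw (Z i) (multivariateGaussian 0 (1 : Matrix n n ℝ)) P) {N : ℕ}
    (hN : Fintype.card n + 1 < N) : ∀ᵐ ω ∂P, (gram Z N ω).det ≠ 0 := by
  have h := ae_det_sumOuter_ne_zero (ι := Fin N) (n := n) (by simpa using hN)
  have hl := hasLaw_uncurry_stdNormal hZ hlaw N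
  rw [← hl.map_eq] at h
  exact ae_of_ae_map hl.aemeasurable h

omit [IsProbabilityMeasure P] in
lemma integral_trace_inv_gram_of_std (hZ : iIndepFun Z P)
    (hlaw : ∀ i, HasLaw (Z i) (multivariateGaussian 0 (1 : Matrix n n ℝ)) P) {N : ℕ}
    (hN : Fintype.card n + 1 < N) : Integrable (fun ω => ((gram Z N ω)⁻¹).trace) P ∧
    ∫ ω, ((gram Z N ω)⁻¹).trace ∂P ≤ Fintype.card n / ((N : ℝ) - Fintype.card n - 1) := by
  have h := integrable_trace_inv_sumOuter (ι := Fin N) (n := n) (by simpa using hN)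
  have hl := hasLaw_uncurry_stdNormal hZ hlaw N
  constructor
  · have h1 := h.1
    rw [← hl.map_eq] at h1
    exact h1.comp_aemeasurable hl.aemeasurable
  · have h2 := h.2
    rw [Fintype.card_fin] at h2
    exact (le_of_eq (hl.integral_comp h.1.aestronglyMeasurable)).trans h2

omit [IsProbabilityMeasure P] in
lemma integrable_inv_gram_of_std (hZ : iIndepFun Z P)
    (hlaw : ∀ i, HasLaw (Z i) (multivariateGaussian 0 (1 : Matrix n n ℝ)) P) {N : ℕ}
    (hN : Fintype.card n + 1 < N) (a b : n) : Integrable (fun ω => (gram Z N ω)⁻¹ a b) P :=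
  (integral_trace_inv_gram_of_std hZ hlaw hN).1.mono'
    (aemeasurable_inv_gram (fun i => (hlaw i).aemeasurable) N a b).aestronglyMeasurable
    (ae_of_all _ fun _ => abs_apply_le_trace (posSemidef_sumOuter _).inv a b)

/-- The entries are dominated by N tr(gram⁻¹), which tends almost surely to n, while its mean is at
most Nn/(N - n - 1) → n. The dominating means therefore have the right limit, as
`tendsto_integral_of_abs_le_of_tendsto` requires. -/
lemma tendsto_integral_inv_gram_of_std (hZ : iIndepFun Z P)
    (hlaw : ∀ i, HasLaw (Z i) (multivariateGaussian 0 (1 : Matrix n n ℝ)) P) (a b : n) :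
    Tendsto (fun N : ℕ => (N : ℝ) * ∫ ω, (gram Z N ω)⁻¹ a b ∂P) atTop
      (𝓝 ((1 : Matrix n n ℝ) a b)) := by
  have hm := aemeasurable_inv_gram (P := P) (fun i => (hlaw i).aemeasurable)
  have hlim : ∀ᵐ ω ∂P, Tendsto (fun N : ℕ => (N : ℝ) • (gram Z N ω)⁻¹) atTop (𝓝 1) := by
    simpa using ae_tendsto_inv_gram Matrix.PosDef.one hZ hlaw
  have hC : Tendsto (fun N : ℕ => (N : ℝ) * (Fintype.card n / ((N : ℝ) - Fintype.card n - 1))) atTop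
      (𝓝 (Fintype.card n : ℝ)) := by
    have h1 : Tendsto (fun N : ℕ => (N : ℝ) / ((N : ℝ) + (-Fintype.card n - 1 : ℝ))) atTop (𝓝 1) :=
      tendsto_natCast_div_add_atTop _
    have := h1.mul_const (Fintype.card n : ℝ)
    rw [one_mul] at this
    exact this.congr fun N => by rw [show (N : ℝ) + (-Fintype.card n - 1 : ℝ) = N - Fintype.card n - 1 by ring]; ring
  simp_rw [← integral_const_mul]
  refine tendsto_integral_of_abs_le_of_tendsto (f := fun N ω => (N : ℝ) * (gram Z N ω)⁻¹ a b)
    (h := fun N ω => (N : ℝ) * ((gram Z N ω)⁻¹).trace) (c := Fintype.card n)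
    (fun N => ((hm N a b).const_mul _).aestronglyMeasurable)
    (fun N => (AEMeasurable.const_mul ?_ _).aestronglyMeasurable) ?_ ?_ ?_ ?_ ?_ hC
  · simp only [Matrix.trace, Matrix.diag]
    exact Finset.aemeasurable_fun_sum _ fun a _ => hm N a a
  · filter_upwards [eventually_gt_atTop (Fintype.card n + 1)] with N hN
    exact (integral_trace_inv_gram_of_std hZ hlaw hN).1.const_mul _
  · intro N ω
    rw [abs_mul, Nat.abs_cast]
    exact mul_le_mul_of_nonneg_left (abs_apply_le_trace (posSemidef_sumOuter _).inv a b)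
      (Nat.cast_nonneg _)
  · filter_upwards [hlim] with ω hω
    exact tendsto_pi_nhds.1 (tendsto_pi_nhds.1 hω a) b
  · filter_upwards [hlim] with ω hω
    have := ((continuous_id (X := Matrix n n ℝ)).matrix_trace.tendsto _).comp hω
    simpa [Function.comp_def] using this
  · filter_upwards [eventually_gt_atTop (Fintype.card n + 1)] with N hN
    rw [integral_const_mul]
    exact mul_le_mul_of_nonneg_left (integral_trace_inv_gram_of_std hZ hlaw hN).2
      (Nat.cast_nonneg _)

end StandardSamples

/-! ### Whitening: from a general covariance Γ to the identity. -/

section Samples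

open scoped MatrixOrder

variable {n : Type*} [Fintype n] [DecidableEq n] {Γ : Matrix n n ℝ}
  {Ω : Type*} [MeasurableSpace Ω] {P : Measure Ω} [IsProbabilityMeasure P]
  {Y : ℕ → Ω → EuclideanSpace ℝ n}

lemma isHermitian_cfcSqrt (Γ : Matrix n n ℝ) : (CFC.sqrt Γ)ᵀ = CFC.sqrt Γ := by
  have := (CFC.sqrt_nonneg Γ).isSelfAdjoint
  simpa [IsSelfAdjoint, star_eq_conjTranspose] using this

lemma isUnit_det_cfcSqrt (hΓ : Γ.PosDef) : IsUnit (CFC.sqrt Γ).det := by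
  have h := CFC.sqrt_mul_sqrt_self Γ hΓ.posSemidef.nonneg
  have h2 : (CFC.sqrt Γ).det * (CFC.sqrt Γ).det = Γ.det := by rw [← det_mul, h]
  have h3 := hΓ.det_pos
  rw [isUnit_iff_ne_zero]
  intro h0
  rw [h0] at h2
  linarith

/-- The whitened observations `Γ^(-1/2) Y i`. -/
noncomputable def whiten (Γ : Matrix n n ℝ) (Y : ℕ → Ω → EuclideanSpace ℝ n) (i : ℕ) (ω : Ω) :
    EuclideanSpace ℝ n := toEuclideanCLM (𝕜 := ℝ) (CFC.sqrt Γ)⁻¹ (Y i ω)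

omit [MeasurableSpace Ω] in
-- Makes each entry of gram⁻¹ a fixed linear combination of entries of the whitened inverse, so
-- invertibility, integrability and limits of means carry over.
lemma gram_eq_mul_gram_whiten_mul (hΓ : Γ.PosDef) (N : ℕ) (ω : Ω) :
    gram Y N ω = CFC.sqrt Γ * gram (whiten Γ Y) N ω * CFC.sqrt Γ := by
  have h : ∀ i a, Y i ω a = ∑ b, CFC.sqrt Γ a b * whiten Γ Y i ω b := fun i a => by
    have e : toEuclideanCLM (𝕜 := ℝ) (CFC.sqrt Γ) (whiten Γ Y i ω) = Y i ω := by
      rw [whiten, ← mul_apply_eq_comp, ← map_mul,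
        mul_nonsing_inv _ (isUnit_det_cfcSqrt hΓ), map_one]
      rfl
    have := congrArg (fun v : EuclideanSpace ℝ n => v a) e
    simp only [Matrix.ofLp_toEuclideanCLM] at this
    rw [← this]; rfl
  have hm : (Matrix.of fun a (i : Fin N) => Y i ω a) =
      CFC.sqrt Γ * Matrix.of fun a (i : Fin N) => whiten Γ Y i ω a := by
    ext a i; simp [Matrix.mul_apply, h i a]
  rw [gram_eq_mul_transpose, gram_eq_mul_transpose, hm, transpose_mul, isHermitian_cfcSqrt]
  simp only [Matrix.mul_assoc]

omit [IsProbabilityMeasure P] in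
lemma hasLaw_whiten (hΓ : Γ.PosDef) {i : ℕ} (hlaw : HasLaw (Y i) (multivariateGaussian 0 Γ) P) :
    HasLaw (whiten Γ Y i) (multivariateGaussian 0 (1 : Matrix n n ℝ)) P := by
  have : HasLaw (fun y => toEuclideanCLM (𝕜 := ℝ) (CFC.sqrt Γ)⁻¹ y)
      (multivariateGaussian 0 (1 : Matrix n n ℝ)) (multivariateGaussian 0 Γ) := by
    refine ⟨by fun_prop, ?_⟩
    rw [multivariateGaussian_zero_one, multivariateGaussian, Measure.map_map (by fun_prop) (by fun_prop)]
    convert! Measure.map_id using 2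
    ext1 y
    simp only [Function.comp, zero_add]
    rw [← mul_apply_eq_comp, ← map_mul, nonsing_inv_mul _ (isUnit_det_cfcSqrt hΓ),
      map_one]
    rfl
  exact this.fun_comp hlaw

variable (hΓ : Γ.PosDef) (hY : iIndepFun Y P)
  (hlaw : ∀ i, HasLaw (Y i) (multivariateGaussian 0 Γ) P)
include hΓ hY hlaw

omit [IsProbabilityMeasure P] hΓ hlaw in
lemma iIndepFun_whiten : iIndepFun (whiten Γ Y) P :=
  hY.comp (fun _ y => toEuclideanCLM (𝕜 := ℝ) (CFC.sqrt Γ)⁻¹ y) fun _ => by fun_prop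

omit [IsProbabilityMeasure P] in
lemma ae_det_gram_ne_zero {N : ℕ} (hN : Fintype.card n + 1 < N) :
    ∀ᵐ ω ∂P, (gram Y N ω).det ≠ 0 := by
  filter_upwards [ae_det_gram_ne_zero_of_std (iIndepFun_whiten hY)
    (fun i => hasLaw_whiten hΓ (hlaw i)) hN] with ω hω
  have := (isUnit_det_cfcSqrt hΓ).ne_zero
  rw [gram_eq_mul_gram_whiten_mul hΓ, det_mul, det_mul]
  exact mul_ne_zero (mul_ne_zero this hω) this

omit [MeasurableSpace Ω] [IsProbabilityMeasure P] hY hlaw in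
lemma inv_gram_apply (N : ℕ) (ω : Ω) (a b : n) : (gram Y N ω)⁻¹ a b =
    ∑ d, ∑ c, (CFC.sqrt Γ)⁻¹ a c * (CFC.sqrt Γ)⁻¹ d b * (gram (whiten Γ Y) N ω)⁻¹ c d := by
  rw [gram_eq_mul_gram_whiten_mul hΓ, Matrix.mul_inv_rev, Matrix.mul_inv_rev, ← mul_assoc]
  simp only [Matrix.mul_apply, Finset.sum_mul]
  exact Finset.sum_congr rfl fun d _ => Finset.sum_congr rfl fun c _ => by ring

omit [IsProbabilityMeasure P] in
lemma integrable_inv_gram {N : ℕ} (hN : Fintype.card n + 1 < N) (a b : n) :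
    Integrable (fun ω => (gram Y N ω)⁻¹ a b) P := by
  have hinv := inv_gram_apply (Y := Y) hΓ
  simp only [hinv]
  exact integrable_finsetSum _ fun d _ => integrable_finsetSum _ fun c _ =>
    (integrable_inv_gram_of_std (iIndepFun_whiten hY)
      (fun i => hasLaw_whiten hΓ (hlaw i)) hN c d).const_mul _

/-- The mean of the inverse of the Gram matrix of `N` observations is `N⁻¹ Γ⁻¹ + o(N⁻¹)`. -/
lemma tendsto_integral_inv_gram (a b : n) :
    Tendsto (fun N : ℕ => (N : ℝ) * ∫ ω, (gram Y N ω)⁻¹ a b ∂P) atTop (𝓝 (Γ⁻¹ a b)) := by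
  have hw := iIndepFun_whiten (Γ := Γ) hY
  have hwl := fun i => hasLaw_whiten hΓ (hlaw i)
  have h : Tendsto (fun N : ℕ => ∑ d, ∑ c, (CFC.sqrt Γ)⁻¹ a c * (CFC.sqrt Γ)⁻¹ d b *
      ((N : ℝ) * ∫ ω, (gram (whiten Γ Y) N ω)⁻¹ c d ∂P)) atTop
      (𝓝 (∑ d, ∑ c, (CFC.sqrt Γ)⁻¹ a c * (CFC.sqrt Γ)⁻¹ d b * (1 : Matrix n n ℝ) c d)) :=
    tendsto_finsetSum _ fun d _ => tendsto_finsetSum _ fun c _ =>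
      (tendsto_integral_inv_gram_of_std hw hwl c d).const_mul _
  have e : Γ⁻¹ a b =
      ∑ d, ∑ c, (CFC.sqrt Γ)⁻¹ a c * (CFC.sqrt Γ)⁻¹ d b * (1 : Matrix n n ℝ) c d := by
    conv_lhs => rw [← CFC.sqrt_mul_sqrt_self Γ hΓ.posSemidef.nonneg, Matrix.mul_inv_rev]
    simp [Matrix.mul_apply, Matrix.one_apply]
  rw [e]
  refine h.congr' ?_
  filter_upwards [eventually_gt_atTop (Fintype.card n + 1)] with N hN
  have hi := integrable_inv_gram_of_std hw hwl hN
  have hinv := inv_gram_apply (Y := Y) hΓ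
  simp only [hinv]
  rw [integral_finsetSum _ fun d _ => integrable_finsetSum _ fun c _ => (hi c d).const_mul _,
    Finset.mul_sum]
  refine Finset.sum_congr rfl fun d _ => ?_
  rw [integral_finsetSum _ fun c _ => (hi c d).const_mul _, Finset.mul_sum]
  refine Finset.sum_congr rfl fun c _ => ?_
  rw [integral_const_mul]
  ring

end Samples

/-! ### Equivalence of the forward and inverse regressions. -/

section Model

variable {D L : ℕ} {Γ : Matrix (Fin L) (Fin L) ℝ} {S : Matrix (Fin D) (Fin D) ℝ}
  (A : Matrix (Fin D) (Fin L) ℝ)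

lemma posDef_inv_add (hΓ : Γ.PosDef) (hS : S.PosDef) : (Γ⁻¹ + Aᵀ * S⁻¹ * A).PosDef := by
  refine hΓ.inv.add_posSemidef ?_
  simpa using hS.inv.posSemidef.conjTranspose_mul_mul_same A

lemma posDef_add_mul_mul_transpose (hΓ : Γ.PosDef) (hS : S.PosDef) : (S + A * Γ * Aᵀ).PosDef := by
  refine hS.add_posSemidef ?_
  simpa using hΓ.posSemidef.mul_mul_conjTranspose_same A

/-- Both sides are the cross-covariance of Y and X. Algebraically, (Γ⁻¹ + AᵀS⁻¹A)ΓAᵀ = AᵀS⁻¹(S +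
AΓAᵀ). -/
lemma g_mul_covariance (hΓ : Γ.PosDef) (hS : S.PosDef) :
    g Γ S A * (S + A * Γ * Aᵀ) = Γ * Aᵀ := by
  have h1 : (Γ⁻¹ + Aᵀ * S⁻¹ * A) * (Γ * Aᵀ) = Aᵀ * S⁻¹ * (S + A * Γ * Aᵀ) := by
    rw [Matrix.add_mul, Matrix.mul_add, ← Matrix.mul_assoc, nonsing_inv_mul _ hΓ.det_pos.ne'.isUnit, Matrix.one_mul,
      Matrix.mul_assoc Aᵀ S⁻¹ S, nonsing_inv_mul _ hS.det_pos.ne'.isUnit, Matrix.mul_one]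
    simp only [Matrix.mul_assoc]
  rw [g, Matrix.mul_assoc _ Aᵀ, Matrix.mul_assoc, ← h1, ← Matrix.mul_assoc,
    nonsing_inv_mul _ (posDef_inv_add A hΓ hS).det_pos.ne'.isUnit, Matrix.one_mul]

/-- Both sides are the covariance of Y, computed from the forward and from the inverse regression.
-/
lemma covariance_mul_transpose_add_sigmaStar (hΓ : Γ.PosDef) (hS : S.PosDef) :
    g Γ S A * (S + A * Γ * Aᵀ) * (g Γ S A)ᵀ + sigmaStar Γ S A = Γ := by
  have hΓt : Γᵀ = Γ := (conjTranspose_eq_transpose_of_trivial Γ).symm.trans hΓ.1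
  have hSt : Sᵀ = S := (conjTranspose_eq_transpose_of_trivial S).symm.trans hS.1
  have hg : (g Γ S A)ᵀ = S⁻¹ * A * (Γ⁻¹ + Aᵀ * S⁻¹ * A)⁻¹ := by
    rw [g, transpose_mul, transpose_mul, transpose_nonsing_inv, transpose_nonsing_inv,
      transpose_add, transpose_nonsing_inv, transpose_mul, transpose_mul, transpose_nonsing_inv]
    simp only [hΓt, hSt, transpose_transpose, Matrix.mul_assoc]
  have h1 : Γ * Aᵀ * (S⁻¹ * A * (Γ⁻¹ + Aᵀ * S⁻¹ * A)⁻¹) + (Γ⁻¹ + Aᵀ * S⁻¹ * A)⁻¹ =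
      Γ * ((Γ⁻¹ + Aᵀ * S⁻¹ * A) * (Γ⁻¹ + Aᵀ * S⁻¹ * A)⁻¹) := by
    rw [← Matrix.mul_assoc Γ, mul_add, mul_nonsing_inv _ hΓ.det_pos.ne'.isUnit, add_mul, one_mul,
      add_comm]
    simp only [Matrix.mul_assoc]
  rw [g_mul_covariance A hΓ hS, hg, sigmaStar, h1,
    mul_nonsing_inv _ (posDef_inv_add A hΓ hS).det_pos.ne'.isUnit, Matrix.mul_one]

/-- Equality of the exponents in the characteristic functions of the two descriptions of the joint
law. -/
lemma quadratic_forward_eq_inverse (hΓ : Γ.PosDef) (hS : S.PosDef) (s : Fin L → ℝ)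
    (v : Fin D → ℝ) :
    (v + (g Γ S A)ᵀ *ᵥ s) ⬝ᵥ ((S + A * Γ * Aᵀ) *ᵥ (v + (g Γ S A)ᵀ *ᵥ s)) +
        s ⬝ᵥ (sigmaStar Γ S A *ᵥ s) =
      (s + Aᵀ *ᵥ v) ⬝ᵥ (Γ *ᵥ (s + Aᵀ *ᵥ v)) + v ⬝ᵥ (S *ᵥ v) := by
  have hΓt : Γᵀ = Γ := (conjTranspose_eq_transpose_of_trivial Γ).symm.trans hΓ.1
  have hCt : (S + A * Γ * Aᵀ)ᵀ = S + A * Γ * Aᵀ := 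
    (conjTranspose_eq_transpose_of_trivial _).symm.trans (posDef_add_mul_mul_transpose A hΓ hS).1
  have id1 := g_mul_covariance A hΓ hS
  have id2 := covariance_mul_transpose_add_sigmaStar A hΓ hS
  have id1t : (S + A * Γ * Aᵀ) * (g Γ S A)ᵀ = A * Γ := by
    have := congrArg transpose id1
    rwa [transpose_mul, transpose_mul, hCt, transpose_transpose, hΓt] at this
  set C := S + A * Γ * Aᵀ with hC
  set G := g Γ S A
  have swap : ∀ {m : ℕ} (M : Matrix (Fin m) (Fin m) ℝ), Mᵀ = M → ∀ x y : Fin m → ℝ,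
      x ⬝ᵥ (M *ᵥ y) = y ⬝ᵥ (M *ᵥ x) := fun M hM x y => by
    rw [dotProduct_mulVec, ← mulVec_transpose, hM, dotProduct_comm]
  have e1 : C *ᵥ (Gᵀ *ᵥ s) = A *ᵥ (Γ *ᵥ s) := by rw [mulVec_mulVec, id1t, mulVec_mulVec]
  have e2 : (Gᵀ *ᵥ s) ⬝ᵥ (C *ᵥ (Gᵀ *ᵥ s)) + s ⬝ᵥ (sigmaStar Γ S A *ᵥ s) = s ⬝ᵥ (Γ *ᵥ s) := by
    rw [mulVec_transpose, ← dotProduct_mulVec, ← mulVec_transpose, mulVec_mulVec, mulVec_mulVec,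
      ← dotProduct_add, ← add_mulVec, id2]
  have e3 : v ⬝ᵥ (C *ᵥ v) = v ⬝ᵥ (S *ᵥ v) + (Aᵀ *ᵥ v) ⬝ᵥ (Γ *ᵥ (Aᵀ *ᵥ v)) := by
    rw [hC, add_mulVec, dotProduct_add, mulVec_transpose A v, ← dotProduct_mulVec,
      ← mulVec_transpose, mulVec_mulVec, mulVec_mulVec]
  have e4 : v ⬝ᵥ (A *ᵥ (Γ *ᵥ s)) = (Aᵀ *ᵥ v) ⬝ᵥ (Γ *ᵥ s) := by
    rw [mulVec_transpose A v, ← dotProduct_mulVec]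
  rw [mulVec_add, add_dotProduct, dotProduct_add, dotProduct_add, swap C hCt (Gᵀ *ᵥ s) v,
    mulVec_add, add_dotProduct, dotProduct_add, dotProduct_add, swap Γ hΓt s (Aᵀ *ᵥ v)]
  rw [e1] at *
  rw [e3, e4]
  linarith

/-- The forward and the inverse regressions define the same joint law. -/
lemma map_forward_eq_prod (hΓ : Γ.PosDef) (hS : S.PosDef) :
    ((multivariateGaussian 0 (S + A * Γ * Aᵀ)).prod (multivariateGaussian 0 (sigmaStar Γ S A))).map
      (fun p : EuclideanSpace ℝ (Fin D) × EuclideanSpace ℝ (Fin L) =>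
        (p.2 + toEuclideanLin (g Γ S A) p.1,
          p.1 - toEuclideanLin A (p.2 + toEuclideanLin (g Γ S A) p.1))) =
    (multivariateGaussian 0 Γ).prod (multivariateGaussian 0 S) := by
  have hc1 : Continuous (toEuclideanLin (g Γ S A)) := LinearMap.continuous_of_finiteDimensional _
  have hc2 : Continuous (toEuclideanLin A) := LinearMap.continuous_of_finiteDimensional _
  have hm : Measurable (fun p : EuclideanSpace ℝ (Fin D) × EuclideanSpace ℝ (Fin L) =>
        (p.2 + toEuclideanLin (g Γ S A) p.1,
          p.1 - toEuclideanLin A (p.2 + toEuclideanLin (g Γ S A) p.1))) := by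
    refine Continuous.measurable ?_
    fun_prop
  have := Measure.isProbabilityMeasure_map (μ := (multivariateGaussian 0 (S + A * Γ * Aᵀ)).prod
    (multivariateGaussian 0 (sigmaStar Γ S A))) hm.aemeasurable
  refine charFun_eq_prod_iff.1 fun t => ?_
  set u := (WithLp.ofLp t).1 with hu
  set v := (WithLp.ofLp t).2 with hv
  -- Regrouping u·Y + v·(X - AY) with Y = A⋆X + ε leaves the coefficient s on ε and v + A⋆ᵀs on X.
  set s : EuclideanSpace ℝ (Fin L) := u - toEuclideanLin Aᵀ v with hs
  have hadj : ∀ {m k : ℕ} (M : Matrix (Fin m) (Fin k) ℝ) (x : EuclideanSpace ℝ (Fin k))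
      (y : EuclideanSpace ℝ (Fin m)),
      inner ℝ (toEuclideanLin M x) y = inner ℝ x (toEuclideanLin Mᵀ y) := fun M x y => by
    simp only [EuclideanSpace.inner_eq_star_dotProduct, toLpLin_apply, star_trivial]
    rw [dotProduct_comm, mulVec_transpose, ← dotProduct_mulVec, dotProduct_comm]
  have key : charFun ((((multivariateGaussian 0 (S + A * Γ * Aᵀ)).prod
      (multivariateGaussian 0 (sigmaStar Γ S A))).map
      (fun p : EuclideanSpace ℝ (Fin D) × EuclideanSpace ℝ (Fin L) =>
        (p.2 + toEuclideanLin (g Γ S A) p.1,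
          p.1 - toEuclideanLin A (p.2 + toEuclideanLin (g Γ S A) p.1)))).map (WithLp.toLp 2)) t =
      charFun (((multivariateGaussian 0 (S + A * Γ * Aᵀ)).prod
      (multivariateGaussian 0 (sigmaStar Γ S A))).map (WithLp.toLp 2))
        (WithLp.toLp 2 (v + toEuclideanLin (g Γ S A)ᵀ s, s)) := by
    rw [charFun_apply, charFun_apply, Measure.map_map (by fun_prop) hm,
      integral_map (by fun_prop) (by fun_prop), integral_map (by fun_prop) (by fun_prop)]
    refine integral_congr_ae (ae_of_all _ fun p => ?_)
    simp only [Function.comp]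
    congr 2
    simp only [WithLp.prod_inner_apply, ← hu, ← hv, hs, map_add, inner_add_left, inner_sub_left,
      inner_add_right, inner_sub_right, hadj, map_sub]
    push_cast
    ring
  rw [key, charFun_prod, charFun_multivariateGaussian hΓ.posSemidef,
    charFun_multivariateGaussian hS.posSemidef,
    charFun_multivariateGaussian (posDef_add_mul_mul_transpose A hΓ hS).posSemidef,
    charFun_multivariateGaussian (S := sigmaStar Γ S A) (posDef_inv_add A hΓ hS).inv.posSemidef, ← Complex.exp_add,
    ← Complex.exp_add]
  have q := quadratic_forward_eq_inverse A hΓ hS s.ofLp v.ofLp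
  have hus : u.ofLp = s.ofLp + Aᵀ *ᵥ v.ofLp := by
    simp [hs]
  rw [← hus] at q
  congr 1
  simp only [inner_zero_right, Complex.ofReal_zero, zero_mul, zero_sub]
  have q' := congrArg (fun x : ℝ => -((x : ℂ) / 2)) q
  simp only [Complex.ofReal_add] at q'
  simp only [WithLp.ofLp_add, toLpLin_apply]
  linear_combination q'

variable {Ω : Type*} [MeasurableSpace Ω] {P : Measure Ω} [IsProbabilityMeasure P]
  {X : ℕ → Ω → EuclideanSpace ℝ (Fin D)} {Y : ℕ → Ω → EuclideanSpace ℝ (Fin L)}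

/-- In the forward regression model, `Y i ∼ N(0, Γ)` and `X i - A (Y i) ∼ N(0, Σ)` are
independent. -/
lemma IsForwardSample.hasLaw_inverse (hΓ : Γ.PosDef) (hS : S.PosDef)
    (h : IsForwardSample P (S + A * Γ * Aᵀ) (g Γ S A) (sigmaStar Γ S A) X Y) (i : ℕ) :
    HasLaw (fun ω => (Y i ω, X i ω - toEuclideanLin A (Y i ω)))
      ((multivariateGaussian 0 Γ).prod (multivariateGaussian 0 S)) P := by
  have hc1 : Continuous (toEuclideanLin (g Γ S A)) := LinearMap.continuous_of_finiteDimensional _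
  have hc2 : Continuous (toEuclideanLin A) := LinearMap.continuous_of_finiteDimensional _
  have h1 := (h.indep_noise i).hasLaw_prod (h.law_covariate i) (h.law_noise i)
  have h2 : HasLaw (fun p : EuclideanSpace ℝ (Fin D) × EuclideanSpace ℝ (Fin L) =>
        (p.2 + toEuclideanLin (g Γ S A) p.1,
          p.1 - toEuclideanLin A (p.2 + toEuclideanLin (g Γ S A) p.1)))
      ((multivariateGaussian 0 Γ).prod (multivariateGaussian 0 S)) _ :=
    ⟨by fun_prop, map_forward_eq_prod A hΓ hS⟩
  simpa using h2.fun_comp h1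

omit [IsProbabilityMeasure P] in
lemma IsForwardSample.iIndepFun_inverse {Γs : Matrix (Fin D) (Fin D) ℝ}
    {As : Matrix (Fin L) (Fin D) ℝ} {Ss : Matrix (Fin L) (Fin L) ℝ}
    (h : IsForwardSample P Γs As Ss X Y) :
    iIndepFun (fun i ω => (Y i ω, X i ω - toEuclideanLin A (Y i ω))) P := by
  have hc2 : Continuous (toEuclideanLin A) := LinearMap.continuous_of_finiteDimensional _
  exact h.indep.comp (fun _ p => (p.2, p.1 - toEuclideanLin A p.2)) fun _ => by fun_prop

end Model

/-! ### First and second moments of the least squares error. -/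

section Regression

variable {d n : Type*} [Fintype d] [Fintype n] [DecidableEq d] [DecidableEq n]
  {Ω : Type*} [MeasurableSpace Ω] {P : Measure Ω} [IsProbabilityMeasure P]
  {Y : ℕ → Ω → EuclideanSpace ℝ n} {e : ℕ → Ω → EuclideanSpace ℝ d}
  {Γ : Matrix n n ℝ} {S : Matrix d d ℝ}

/-- The coefficients `(∑ j, y j (y j)ᵀ)⁻¹ y i` of the least squares estimator. -/
noncomputable def lsCoeff {N : ℕ} (y : Fin N → EuclideanSpace ℝ n) (i : Fin N) (l : n) : ℝ :=
  ((sumOuter fun i a => y i a)⁻¹ *ᵥ fun a => y i a) l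

/-- The error `∑ i, e i ((∑ j, Y j (Y j)ᵀ)⁻¹ (Y i))ᵀ` of the least squares estimator. -/
noncomputable def lsError (Y : ℕ → Ω → EuclideanSpace ℝ n) (e : ℕ → Ω → EuclideanSpace ℝ d)
    (N : ℕ) (ω : Ω) : Matrix d n ℝ :=
  Matrix.of fun a l => ∑ i : Fin N, e i ω a * lsCoeff (fun i : Fin N => Y i ω) i l

lemma measurable_lsCoeff {N : ℕ} (i : Fin N) (l : n) :
    Measurable fun y : Fin N → EuclideanSpace ℝ n => lsCoeff y i l := by
  have h : ∀ a b, Measurable fun y : Fin N → EuclideanSpace ℝ n =>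
      (sumOuter fun i a => y i a)⁻¹ a b := fun a b =>
    measurable_matrix_inv_apply (fun a b => by simp only [sumOuter_apply]; fun_prop) a b
  simp only [lsCoeff, mulVec, dotProduct]
  refine Finset.measurable_sum _ fun b _ => (h l b).mul ?_
  fun_prop

lemma sum_lsCoeff_mul {N : ℕ} (y : Fin N → EuclideanSpace ℝ n) (l l' : n) :
    ∑ i, lsCoeff y i l * lsCoeff y i l' = (sumOuter fun i a => y i a)⁻¹ l l' := by
  set W := sumOuter fun i a => y i a with hW
  have hs : ∀ a b, W⁻¹ a b = W⁻¹ b a := fun a b => by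
    simpa using (posSemidef_sumOuter fun i a => y i a).inv.1.apply b a
  -- True for singular W as well, since then W⁻¹ = 0; no almost sure exception is needed.
  have hp : W⁻¹ * W * W⁻¹ = W⁻¹ := by
    by_cases h : IsUnit W.det
    · rw [nonsing_inv_mul _ h, Matrix.one_mul]
    · simp [nonsing_inv_apply_not_isUnit _ h]
  have h2 := dotProduct_sumOuter_mulVec (fun i a => y i a) (W⁻¹ l) (W⁻¹.col l')
  rw [← hW] at h2
  have h3 : W⁻¹ l ⬝ᵥ (W *ᵥ W⁻¹.col l') = (W⁻¹ * W * W⁻¹) l l' := by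
    rw [Matrix.mul_assoc]; rfl
  rw [h3, hp] at h2
  rw [h2]
  refine Finset.sum_congr rfl fun i _ => ?_
  congr 1
  · exact dotProduct_comm _ _
  · simp only [lsCoeff, mulVec, dotProduct, Matrix.col_apply]
    exact Finset.sum_congr rfl fun b _ => by rw [← hW, hs l' b, mul_comm]

variable (hlaw : ∀ i, HasLaw (fun ω => (Y i ω, e i ω))
    ((multivariateGaussian 0 Γ).prod (multivariateGaussian 0 S)) P)
include hlaw

omit [IsProbabilityMeasure P] in
lemma hasLaw_left (i : ℕ) : HasLaw (Y i) (multivariateGaussian 0 Γ) P :=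
  (measurePreserving_fst (μ := multivariateGaussian (0 : EuclideanSpace ℝ n) Γ)
    (ν := multivariateGaussian (0 : EuclideanSpace ℝ d) S)).hasLaw.fun_comp (hlaw i)

omit [IsProbabilityMeasure P] in
lemma hasLaw_right (i : ℕ) : HasLaw (e i) (multivariateGaussian 0 S) P :=
  (measurePreserving_snd (μ := multivariateGaussian (0 : EuclideanSpace ℝ n) Γ)
    (ν := multivariateGaussian (0 : EuclideanSpace ℝ d) S)).hasLaw.fun_comp (hlaw i)

variable (hpair : iIndepFun (fun i ω => (Y i ω, e i ω)) P)
include hpair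

omit [IsProbabilityMeasure P] in
lemma hasLaw_tuples (N : ℕ) : HasLaw (fun ω => ((fun i : Fin N => Y i ω), fun i : Fin N => e i ω))
    ((Measure.pi fun _ : Fin N => multivariateGaussian 0 Γ).prod
      (Measure.pi fun _ : Fin N => multivariateGaussian 0 S)) P :=
  (measurePreserving_arrowProdEquivProdArrow (EuclideanSpace ℝ n) (EuclideanSpace ℝ d) (Fin N)
    (fun _ => multivariateGaussian 0 Γ) (fun _ => multivariateGaussian 0 S)).hasLaw.fun_comp
    ((hpair.precomp Fin.val_injective).hasLaw_pi fun i => hlaw i)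

omit hlaw [IsProbabilityMeasure P] [Fintype d] [Fintype n] [DecidableEq d] [DecidableEq n] in
lemma iIndepFun_left : iIndepFun Y P := hpair.comp (fun _ p => p.1) fun _ => measurable_fst

omit hlaw [IsProbabilityMeasure P] [Fintype d] [Fintype n] [DecidableEq d] [DecidableEq n] in
lemma iIndepFun_right : iIndepFun e P := hpair.comp (fun _ p => p.2) fun _ => measurable_snd

/-- The joint law of regressors and noise is a product, which is what allows the noise to be
integrated out with the regressors fixed. -/
lemma indepFun_tuples (N : ℕ) :
    IndepFun (fun ω (i : Fin N) => Y i ω) (fun ω (i : Fin N) => e i ω) P := by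
  have h1 := ((iIndepFun_left hpair).precomp (g := fun i : Fin N => (i : ℕ))
    Fin.val_injective).hasLaw_pi fun i : Fin N => hasLaw_left hlaw i
  have h2 := ((iIndepFun_right hpair).precomp (g := fun i : Fin N => (i : ℕ))
    Fin.val_injective).hasLaw_pi fun i : Fin N => hasLaw_right hlaw i
  exact (indepFun_iff_hasLaw_prodMk_prod h1 h2).2 (hasLaw_tuples hlaw hpair N)

omit hlaw hpair [IsProbabilityMeasure P] [DecidableEq d] in
lemma aemeasurable_lsCoeff (hYm : ∀ i, AEMeasurable (Y i) P) {N : ℕ} (i : Fin N) (l : n) :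
    AEMeasurable (fun ω => lsCoeff (fun i : Fin N => Y i ω) i l) P :=
  (measurable_lsCoeff i l).comp_aemeasurable (aemeasurable_pi_lambda _ fun i => hYm i)

omit [IsProbabilityMeasure P] hpair in
lemma aemeasurable_lsError (N : ℕ) (a : d) (l : n) :
    AEMeasurable (fun ω => lsError Y e N ω a l) P := by
  have h1 := aemeasurable_lsCoeff (N := N) fun i => (hasLaw_left hlaw i).aemeasurable
  have h2 := fun i => (hasLaw_right hlaw i).aemeasurable
  simp only [lsError, Matrix.of_apply]
  refine Finset.aemeasurable_fun_sum _ fun i _ => AEMeasurable.mul ?_ (h1 i l)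
  have := h2 i
  fun_prop

omit hpair [IsProbabilityMeasure P] in
lemma memLp_noise (i : ℕ) (a : d) : MemLp (fun ω => e i ω a) 2 P := by
  have h : MemLp (fun y : EuclideanSpace ℝ d => y a) 2 (multivariateGaussian 0 S) :=
    (EuclideanSpace.proj (𝕜 := ℝ) a).comp_memLp' IsGaussian.memLp_two_id
  rw [← (hasLaw_right hlaw i).map_eq] at h
  exact h.comp_of_map (hasLaw_right hlaw i).aemeasurable

omit hpair [IsProbabilityMeasure P] in
lemma integral_noise (i : ℕ) (a : d) : ∫ ω, e i ω a ∂P = 0 := by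
  rw [← integral_eval_multivariateGaussian (Γ := S) a]
  exact (hasLaw_right hlaw i).integral_comp (f := fun y : EuclideanSpace ℝ d => y a)
    (Measurable.aestronglyMeasurable (by fun_prop))

omit [IsProbabilityMeasure P] in
lemma integral_noise_mul (hS : S.PosSemidef) (i j : ℕ) (a b : d) :
    ∫ ω, e i ω a * e j ω b ∂P = if i = j then S a b else 0 := by
  split_ifs with h
  · subst h
    rw [← integral_mul_multivariateGaussian hS a b]
    exact (hasLaw_right hlaw i).integral_comp (f := fun y : EuclideanSpace ℝ d => y a * y b)
      (Measurable.aestronglyMeasurable (by fun_prop))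
  · have hi : IndepFun (fun ω => e i ω a) (fun ω => e j ω b) P :=
      ((iIndepFun_right hpair).indepFun h).comp (φ := fun y : EuclideanSpace ℝ d => y a)
        (ψ := fun y : EuclideanSpace ℝ d => y b)
        (by fun_prop) (by fun_prop)
    rw [hi.integral_fun_mul_eq_mul_integral (memLp_noise hlaw i a).aestronglyMeasurable
      (memLp_noise hlaw j b).aestronglyMeasurable, integral_noise hlaw, zero_mul]

variable (hΓ : Γ.PosDef)
include hΓ

omit [IsProbabilityMeasure P] in
-- The squares over i sum to a diagonal entry of gram⁻¹, which is integrable for N > card n + 1.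
lemma memLp_lsCoeff {N : ℕ} (hN : Fintype.card n + 1 < N) (i : Fin N) (l : n) :
    MemLp (fun ω => lsCoeff (fun i : Fin N => Y i ω) i l) 2 P := by
  have hm := aemeasurable_lsCoeff (fun i => (hasLaw_left hlaw i).aemeasurable) i l
  rw [memLp_two_iff_integrable_sq hm.aestronglyMeasurable]
  refine (integrable_inv_gram hΓ (iIndepFun_left hpair) (hasLaw_left hlaw) hN l l).mono'
    (hm.pow_const 2).aestronglyMeasurable (ae_of_all _ fun ω => ?_)
  have h := sum_lsCoeff_mul (fun i : Fin N => Y i ω) l l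
  rw [Real.norm_of_nonneg (sq_nonneg _), gram, ← h, sq]
  exact Finset.single_le_sum (f := fun i => lsCoeff (fun i : Fin N => Y i ω) i l *
    lsCoeff (fun i : Fin N => Y i ω) i l) (fun i _ => mul_self_nonneg _) (Finset.mem_univ i)

lemma memLp_noise_mul_lsCoeff {N : ℕ} (hN : Fintype.card n + 1 < N) (i : Fin N) (a : d) (l : n) :
    MemLp (fun ω => e i ω a * lsCoeff (fun i : Fin N => Y i ω) i l) 2 P := by
  have h1 := memLp_noise hlaw i a
  have h2 := memLp_lsCoeff hlaw hpair hΓ hN i l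
  refine (memLp_two_iff_integrable_sq (h1.aestronglyMeasurable.mul h2.aestronglyMeasurable)).2 ?_
  have hi : IndepFun (fun ω => e i ω a ^ 2)
      (fun ω => lsCoeff (fun i : Fin N => Y i ω) i l ^ 2) P :=
    (indepFun_tuples hlaw hpair N).symm.comp (φ := fun z : Fin N → EuclideanSpace ℝ d => z i a ^ 2)
      (ψ := fun y => lsCoeff y i l ^ 2) (by fun_prop) ((measurable_lsCoeff i l).pow_const 2)
  refine (hi.integrable_mul h1.integrable_sq h2.integrable_sq).congr (ae_of_all _ fun ω => ?_)
  simp [mul_pow]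

lemma memLp_lsError {N : ℕ} (hN : Fintype.card n + 1 < N) (a : d) (l : n) :
    MemLp (fun ω => lsError Y e N ω a l) 2 P := by
  simp only [lsError, Matrix.of_apply]
  exact memLp_finsetSum _ fun i _ => memLp_noise_mul_lsCoeff hlaw hpair hΓ hN i a l

lemma integral_lsError {N : ℕ} (hN : Fintype.card n + 1 < N) (a : d) (l : n) :
    ∫ ω, lsError Y e N ω a l ∂P = 0 := by
  simp only [lsError, Matrix.of_apply]
  rw [integral_finsetSum _ fun i _ =>
    (memLp_noise_mul_lsCoeff hlaw hpair hΓ hN i a l).integrable one_le_two]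
  refine Finset.sum_eq_zero fun i _ => ?_
  have hi : IndepFun (fun ω => e i ω a) (fun ω => lsCoeff (fun i : Fin N => Y i ω) i l) P :=
    (indepFun_tuples hlaw hpair N).symm.comp (φ := fun z : Fin N → EuclideanSpace ℝ d => z i a)
      (ψ := fun y => lsCoeff y i l) (by fun_prop) (measurable_lsCoeff i l)
  rw [hi.integral_fun_mul_eq_mul_integral (memLp_noise hlaw i a).aestronglyMeasurable
    (memLp_lsCoeff hlaw hpair hΓ hN i l).aestronglyMeasurable, integral_noise hlaw, zero_mul]

/-- The covariances of the entries of the least squares error. -/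
lemma integral_lsError_mul (hS : S.PosSemidef) {N : ℕ} (hN : Fintype.card n + 1 < N) (a b : d)
    (l m : n) : ∫ ω, lsError Y e N ω a l * lsError Y e N ω b m ∂P =
      S a b * ∫ ω, (gram Y N ω)⁻¹ l m ∂P := by
  set u : Fin N → n → Ω → ℝ := fun i l ω => lsCoeff (fun i : Fin N => Y i ω) i l with hu
  have hL := memLp_noise_mul_lsCoeff hlaw hpair hΓ hN
  have hul := memLp_lsCoeff hlaw hpair hΓ hN
  -- Noise and coefficients separate by independence, and distinct noises are uncorrelated; the
  -- surviving diagonal is summed by `sum_lsCoeff_mul`.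
  have hterm : ∀ i j : Fin N, ∫ ω, (e i ω a * u i l ω) * (e j ω b * u j m ω) ∂P =
      if i = j then S a b * ∫ ω, u i l ω * u i m ω ∂P else 0 := fun i j => by
    have hi : IndepFun (fun ω => e i ω a * e j ω b) (fun ω => u i l ω * u j m ω) P :=
      (indepFun_tuples hlaw hpair N).symm.comp (φ := fun z : Fin N → EuclideanSpace ℝ d => z i a * z j b)
        (ψ := fun y => lsCoeff y i l * lsCoeff y j m) (by fun_prop)
        ((measurable_lsCoeff i l).mul (measurable_lsCoeff j m))
    have h1 := hi.integral_fun_mul_eq_mul_integral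
      ((memLp_noise hlaw i a).aestronglyMeasurable.mul (memLp_noise hlaw j b).aestronglyMeasurable)
      ((hul i l).aestronglyMeasurable.mul (hul j m).aestronglyMeasurable)
    rw [integral_noise_mul hlaw hpair hS] at h1
    have h2 : ∫ ω, (e i ω a * u i l ω) * (e j ω b * u j m ω) ∂P =
        ∫ ω, (e i ω a * e j ω b) * (u i l ω * u j m ω) ∂P := by
      congr 1; ext ω; ring
    rw [h2, h1]
    by_cases hij : i = j
    · subst hij; simp
    · rw [if_neg hij, if_neg (fun h => hij (Fin.ext h)), zero_mul]
  have hsum : ∀ ω, lsError Y e N ω a l * lsError Y e N ω b m =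
      ∑ i : Fin N, ∑ j : Fin N, (e i ω a * u i l ω) * (e j ω b * u j m ω) := fun ω => by
    simp only [lsError, Matrix.of_apply, Finset.sum_mul_sum, hu]
  have hLL : ∀ i j : Fin N, Integrable (fun ω => (e i ω a * u i l ω) * (e j ω b * u j m ω)) P :=
    fun i j => (hL i a l).integrable_mul (hL j b m)
  have hUU : ∀ i : Fin N, Integrable (fun ω => u i l ω * u i m ω) P :=
    fun i => (hul i l).integrable_mul (hul i m)
  simp only [hsum]
  rw [integral_finsetSum _ fun i _ => integrable_finsetSum _ fun j _ => hLL i j]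
  have : ∀ i : Fin N, ∫ ω, ∑ j : Fin N, (e i ω a * u i l ω) * (e j ω b * u j m ω) ∂P =
      S a b * ∫ ω, u i l ω * u i m ω ∂P := fun i => by
    rw [integral_finsetSum _ fun j _ => hLL i j]
    simp only [hterm]
    simp
  simp only [this]
  rw [← Finset.mul_sum, ← integral_finsetSum _ fun i _ => hUU i]
  congr 2
  ext ω
  exact sum_lsCoeff_mul (fun i : Fin N => Y i ω) l m

end Regression

open scoped Kronecker

/-! ### Asymptotic normality through the conditional Gaussian law. -/

section CentralLimit

variable {d n : Type*} [Fintype d] [Fintype n] [DecidableEq d] [DecidableEq n]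
  {Ω : Type*} [MeasurableSpace Ω] {P : Measure Ω} [IsProbabilityMeasure P]
  {Y : ℕ → Ω → EuclideanSpace ℝ n} {e : ℕ → Ω → EuclideanSpace ℝ d}
  {Γ : Matrix n n ℝ} {S : Matrix d d ℝ}

/-- The vectorised least squares error, scaled by `√N`. -/
noncomputable def scaledError (Y : ℕ → Ω → EuclideanSpace ℝ n) (e : ℕ → Ω → EuclideanSpace ℝ d)
    (N : ℕ) (ω : Ω) : EuclideanSpace ℝ (d × n) :=
  WithLp.toLp 2 fun p => √N * lsError Y e N ω p.1 p.2

/-- The weights with which the noise enters a linear functional of the scaled error. -/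
noncomputable def noiseWeight (t : EuclideanSpace ℝ (d × n)) {N : ℕ}
    (y : Fin N → EuclideanSpace ℝ n) (i : Fin N) : EuclideanSpace ℝ d :=
  WithLp.toLp 2 fun a => √N * ∑ l, t (a, l) * lsCoeff y i l

omit [MeasurableSpace Ω] [DecidableEq d] in
-- A linear functional of the error is linear in the noise, with weights depending on the regressors
-- only.
lemma inner_scaledError (t : EuclideanSpace ℝ (d × n)) (N : ℕ) (ω : Ω) :
    inner ℝ (scaledError Y e N ω) t =
      ∑ i : Fin N, inner ℝ (e i ω) (noiseWeight t (fun i : Fin N => Y i ω) i) := by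
  simp only [EuclideanSpace.inner_eq_star_dotProduct, scaledError, noiseWeight, dotProduct,
    lsError, Matrix.of_apply, star_trivial, Pi.star_apply, Finset.mul_sum, Finset.sum_mul,
    Fintype.sum_prod_type]
  conv_lhs =>
    enter [2, a]
    rw [Finset.sum_comm]
  rw [Finset.sum_comm]
  refine Finset.sum_congr rfl fun i _ => Finset.sum_congr rfl fun a _ =>
    Finset.sum_congr rfl fun l _ => ?_
  ring

omit [DecidableEq d] in
-- For S the noise covariance, this is the variance of that functional given the regressors.
lemma sum_noiseWeight_quadratic (t : EuclideanSpace ℝ (d × n)) {N : ℕ}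
    (y : Fin N → EuclideanSpace ℝ n) (S : Matrix d d ℝ) :
    ∑ i, (noiseWeight t y i).ofLp ⬝ᵥ (S *ᵥ (noiseWeight t y i).ofLp) =
      N * (t.ofLp ⬝ᵥ ((S ⊗ₖ (sumOuter fun i a => y i a)⁻¹) *ᵥ t.ofLp)) := by
  have hN : √(N : ℝ) * √(N : ℝ) = N := Real.mul_self_sqrt (Nat.cast_nonneg _)
  have h1 : ∀ a b, ∑ i, noiseWeight t y i a * noiseWeight t y i b =
      N * ∑ l, ∑ m, t (a, l) * t (b, m) * (sumOuter fun i a => y i a)⁻¹ l m := fun a b => by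
    have h0 : ∀ i, noiseWeight t y i a * noiseWeight t y i b =
        N * ∑ l, ∑ m, t (a, l) * t (b, m) * (lsCoeff y i l * lsCoeff y i m) := fun i => by
      simp only [noiseWeight]
      rw [mul_mul_mul_comm, hN, Finset.sum_mul_sum]
      simp only [mul_mul_mul_comm]
    simp only [h0, ← Finset.mul_sum, ← sum_lsCoeff_mul]
    simp only [Finset.mul_sum]
    rw [Finset.sum_comm]
    refine Finset.sum_congr rfl fun l _ => ?_
    rw [Finset.sum_comm]
  calc ∑ i, (noiseWeight t y i).ofLp ⬝ᵥ (S *ᵥ (noiseWeight t y i).ofLp)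
      = ∑ a, ∑ b, S a b * ∑ i, noiseWeight t y i a * noiseWeight t y i b := by
        simp only [dotProduct, mulVec, Finset.mul_sum]
        rw [Finset.sum_comm]
        refine Finset.sum_congr rfl fun a _ => ?_
        rw [Finset.sum_comm]
        refine Finset.sum_congr rfl fun b _ => Finset.sum_congr rfl fun i _ => ?_
        ring
    _ = _ := by
        simp only [h1, dotProduct, mulVec, kroneckerMap_apply, Fintype.sum_prod_type,
          Finset.mul_sum]
        refine Finset.sum_congr rfl fun a _ => ?_
        rw [Finset.sum_comm]
        refine Finset.sum_congr rfl fun l _ => ?_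
        refine Finset.sum_congr rfl fun b _ => Finset.sum_congr rfl fun m _ => ?_
        ring

omit [Fintype d] [DecidableEq d] in
lemma measurable_noiseWeight (t : EuclideanSpace ℝ (d × n)) {N : ℕ} (i : Fin N) :
    Measurable fun y : Fin N → EuclideanSpace ℝ n => noiseWeight t y i := by
  refine (MeasurableEquiv.toLp 2 (d → ℝ)).measurable.comp (measurable_pi_iff.2 fun a => ?_)
  exact (Finset.measurable_sum _ fun l _ => (measurable_lsCoeff i l).const_mul _).const_mul _

variable (hlaw : ∀ i, HasLaw (fun ω => (Y i ω, e i ω))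
    ((multivariateGaussian 0 Γ).prod (multivariateGaussian 0 S)) P)
include hlaw

omit [IsProbabilityMeasure P] in
lemma aemeasurable_scaledError (N : ℕ) : AEMeasurable (scaledError Y e N) P :=
  (MeasurableEquiv.toLp 2 (d × n → ℝ)).measurable.comp_aemeasurable
    (aemeasurable_pi_lambda _ fun p => (aemeasurable_lsError hlaw N p.1 p.2).const_mul _)

variable (hpair : iIndepFun (fun i ω => (Y i ω, e i ω)) P)
include hpair

omit [IsProbabilityMeasure P] in
/-- Given the regressors, the scaled error is Gaussian. -/
lemma charFun_map_scaledError (hS : S.PosSemidef) (N : ℕ) (t : EuclideanSpace ℝ (d × n)) :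
    charFun (P.map (scaledError Y e N)) t = ∫ ω, Complex.exp
      (-((N * (t.ofLp ⬝ᵥ ((S ⊗ₖ (gram Y N ω)⁻¹) *ᵥ t.ofLp)) / 2 : ℝ) : ℂ)) ∂P := by
  have hw := fun i : Fin N => measurable_noiseWeight t i
  set F : (Fin N → EuclideanSpace ℝ n) × (Fin N → EuclideanSpace ℝ d) → ℂ := fun p =>
    Complex.exp (((∑ i, inner ℝ (p.2 i) (noiseWeight t p.1 i) : ℝ) : ℂ) * Complex.I) with hF
  have hFm : Measurable F := by
    refine Complex.measurable_exp.comp ((Complex.measurable_ofReal.comp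
      (Finset.measurable_sum _ fun i _ => ?_)).mul_const _)
    exact Measurable.inner (by fun_prop) ((hw i).comp measurable_fst)
  have hFint : Integrable F ((Measure.pi fun _ : Fin N => multivariateGaussian 0 Γ).prod
      (Measure.pi fun _ : Fin N => multivariateGaussian 0 S)) :=
    .of_bound hFm.aestronglyMeasurable 1 (ae_of_all _ fun p => by
      rw [hF]; exact (Complex.norm_exp_ofReal_mul_I _).le)
  have hl := hasLaw_tuples hlaw hpair N
  have hlY := ((iIndepFun_left hpair).precomp (g := fun i : Fin N => (i : ℕ))
    Fin.val_injective).hasLaw_pi fun i : Fin N => hasLaw_left hlaw i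
  have hinner : ∀ y : Fin N → EuclideanSpace ℝ n,
      ∫ z, F (y, z) ∂(Measure.pi fun _ : Fin N => multivariateGaussian 0 S) = Complex.exp
        (-((N * (t.ofLp ⬝ᵥ ((S ⊗ₖ (sumOuter fun i a => y i a)⁻¹) *ᵥ t.ofLp)) / 2 : ℝ) : ℂ)) := by
    intro y
    have h1 : ∀ z : Fin N → EuclideanSpace ℝ d, F (y, z) =
        ∏ i, Complex.exp ((inner ℝ (z i) (noiseWeight t y i) : ℝ) * Complex.I) := fun z => by
      simp only [hF, ← Complex.exp_sum, ← Finset.sum_mul, Complex.ofReal_sum]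
    simp only [h1]
    rw [integral_fintype_prod_eq_prod
      (f := fun i z => Complex.exp ((inner ℝ z (noiseWeight t y i) : ℝ) * Complex.I))]
    simp only [← charFun_apply, charFun_multivariateGaussian hS]
    rw [← Complex.exp_sum, ← sum_noiseWeight_quadratic]
    congr 1
    simp [Finset.sum_div]
  calc charFun (P.map (scaledError Y e N)) t
      = ∫ ω, F ((fun i : Fin N => Y i ω), fun i : Fin N => e i ω) ∂P := by
        rw [charFun_apply, integral_map (aemeasurable_scaledError hlaw N)
          (Measurable.aestronglyMeasurable (by fun_prop))]
        simp only [inner_scaledError, hF]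
    _ = ∫ p, F p ∂((Measure.pi fun _ : Fin N => multivariateGaussian 0 Γ).prod
          (Measure.pi fun _ : Fin N => multivariateGaussian 0 S)) :=
        hl.integral_comp hFm.aestronglyMeasurable
    _ = ∫ y, Complex.exp (-((N * (t.ofLp ⬝ᵥ
          ((S ⊗ₖ (sumOuter fun i a => y i a)⁻¹) *ᵥ t.ofLp)) / 2 : ℝ) : ℂ))
          ∂(Measure.pi fun _ : Fin N => multivariateGaussian 0 Γ) := by
        rw [integral_prod _ hFint]
        exact integral_congr_ae (ae_of_all _ hinner)
    _ = _ := by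
        refine (hlY.integral_comp (f := fun y : Fin N → EuclideanSpace ℝ n =>
          Complex.exp (-((N * (t.ofLp ⬝ᵥ
          ((S ⊗ₖ (sumOuter fun i a => y i a)⁻¹) *ᵥ t.ofLp)) / 2 : ℝ) : ℂ))) ?_).symm
        have := hFm.stronglyMeasurable.integral_prod_right'
          (ν := Measure.pi fun _ : Fin N => multivariateGaussian 0 S)
        simpa only [hinner] using this.aestronglyMeasurable

/-- Asymptotic normality of the least squares estimator. -/
lemma tendstoInDistribution_scaledError (hΓ : Γ.PosDef) (hS : S.PosSemidef) :
    TendstoInDistribution (scaledError Y e) atTop id (fun _ => P)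
      (multivariateGaussian 0 (S ⊗ₖ Γ⁻¹)) where
  forall_aemeasurable := aemeasurable_scaledError hlaw
  aemeasurable_limit := aemeasurable_id
  tendsto := by
    refine ProbabilityMeasure.tendsto_of_tendsto_charFun fun t => ?_
    have hK : (S ⊗ₖ Γ⁻¹).PosSemidef := hS.kronecker hΓ.inv.posSemidef
    simp only [ProbabilityMeasure.coe_mk, Measure.map_id, charFun_map_scaledError hlaw hpair hS,
      charFun_multivariateGaussian hK]
    -- The integrand is bounded by 1, its exponent being nonpositive, and converges almost surely to
    -- a constant because N gram⁻¹ → Γ⁻¹.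
    have hlim : Tendsto (fun N : ℕ => ∫ ω, Complex.exp
        (-((N * (t.ofLp ⬝ᵥ ((S ⊗ₖ (gram Y N ω)⁻¹) *ᵥ t.ofLp)) / 2 : ℝ) : ℂ)) ∂P) atTop
        (𝓝 (∫ _, Complex.exp (-((t.ofLp ⬝ᵥ ((S ⊗ₖ Γ⁻¹) *ᵥ t.ofLp) / 2 : ℝ) : ℂ)) ∂P)) := by
      refine tendsto_integral_of_dominated_convergence (fun _ => 1) (fun N => ?_)
        (integrable_const _) (fun N => ae_of_all _ fun ω => ?_) ?_
      · have hm := aemeasurable_inv_gram (P := P) (Y := Y)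
          (fun i => (hasLaw_left hlaw i).aemeasurable) N
        refine AEMeasurable.aestronglyMeasurable ?_
        simp only [dotProduct, mulVec, kroneckerMap_apply]
        refine Complex.measurable_exp.comp_aemeasurable (Complex.measurable_ofReal.comp_aemeasurable
          (AEMeasurable.div_const (AEMeasurable.const_mul ?_ _) _)).neg
        exact Finset.aemeasurable_fun_sum _ fun p _ => AEMeasurable.const_mul
          (Finset.aemeasurable_fun_sum _ fun q _ => ((hm p.2 q.2).const_mul _).mul_const _) _
      · rw [← Complex.ofReal_neg, Complex.norm_exp_ofReal, Real.exp_le_one_iff, neg_nonpos]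
        have : (S ⊗ₖ (gram Y N ω)⁻¹).PosSemidef := hS.kronecker (posSemidef_sumOuter _).inv
        have := this.dotProduct_mulVec_nonneg t.ofLp
        simp only [star_trivial] at this
        positivity
      · filter_upwards [ae_tendsto_inv_gram hΓ (iIndepFun_left hpair) (hasLaw_left hlaw)] with ω hω
        refine (Complex.continuous_exp.tendsto _).comp
          (((Complex.continuous_ofReal.tendsto _).comp ?_).neg)
        refine Tendsto.div_const ?_ _
        have h2 : Tendsto (fun N : ℕ => t.ofLp ⬝ᵥ ((S ⊗ₖ ((N : ℝ) • (gram Y N ω)⁻¹)) *ᵥ t.ofLp))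
            atTop (𝓝 (t.ofLp ⬝ᵥ ((S ⊗ₖ Γ⁻¹) *ᵥ t.ofLp))) := by
          simp only [dotProduct, mulVec, kroneckerMap_apply]
          exact tendsto_finsetSum _ fun p _ => Tendsto.const_mul _
            (tendsto_finsetSum _ fun q _ => Tendsto.mul_const _ (Tendsto.const_mul _
              (tendsto_pi_nhds.1 (tendsto_pi_nhds.1 hω _) _)))
        refine h2.congr fun N => ?_
        rw [kronecker_smul, smul_mulVec, dotProduct_smul, smul_eq_mul]
    convert! hlim using 2
    simp

end CentralLimit

/-! ### Strong consistency of least squares. -/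

section Consistency

variable {d n : Type*} [Fintype d] [Fintype n] [DecidableEq d] [DecidableEq n]
  {Ω : Type*} [MeasurableSpace Ω] {P : Measure Ω} [IsProbabilityMeasure P]
  {Y : ℕ → Ω → EuclideanSpace ℝ n} {e : ℕ → Ω → EuclideanSpace ℝ d}
  {Γ : Matrix n n ℝ} {S : Matrix d d ℝ}

omit [IsProbabilityMeasure P] in
-- The error is a product of N⁻¹ΣYe, which tends to 0 because Y and e are independent and centred,
-- and of N gram⁻¹, which tends to Γ⁻¹.
lemma ae_tendsto_lsError (hΓ : Γ.PosDef)
    (hlaw : ∀ i, HasLaw (fun ω => (Y i ω, e i ω))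
      ((multivariateGaussian 0 Γ).prod (multivariateGaussian 0 S)) P)
    (hpair : iIndepFun (fun i ω => (Y i ω, e i ω)) P) (a : d) (l : n) :
    ∀ᵐ ω ∂P, Tendsto (fun N => lsError Y e N ω a l) atTop (𝓝 0) := by
  have hc : ∀ b, ∀ᵐ ω ∂P, Tendsto (fun N : ℕ => (N : ℝ)⁻¹ * ∑ i : Fin N, Y i ω b * e i ω a)
      atTop (𝓝 0) := fun b => by
    have hY : Integrable (fun y : EuclideanSpace ℝ n => y b) (multivariateGaussian 0 Γ) :=
      ((EuclideanSpace.proj (𝕜 := ℝ) b).comp_memLp'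
        IsGaussian.memLp_two_id).integrable one_le_two
    have he : Integrable (fun y : EuclideanSpace ℝ d => y a) (multivariateGaussian 0 S) :=
      ((EuclideanSpace.proj (𝕜 := ℝ) a).comp_memLp'
        IsGaussian.memLp_two_id).integrable one_le_two
    have h := ae_tendsto_average hpair hlaw (φ := fun p => p.1 b * p.2 a) (by fun_prop)
      (hY.mul_prod he)
    rwa [integral_prod_mul (fun y : EuclideanSpace ℝ n => y b) (fun y : EuclideanSpace ℝ d => y a),
      integral_eval_multivariateGaussian, zero_mul] at h
  filter_upwards [ae_all_iff.2 hc,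
    ae_tendsto_inv_gram hΓ (iIndepFun_left hpair) (hasLaw_left hlaw)] with ω h1 h2
  have h3 : Tendsto (fun N : ℕ => ∑ b, ((N : ℝ)⁻¹ * ∑ i : Fin N, Y i ω b * e i ω a) *
      ((N : ℝ) • (gram Y N ω)⁻¹) l b) atTop (𝓝 (∑ b, 0 * Γ⁻¹ l b)) :=
    tendsto_finsetSum _ fun b _ => (h1 b).mul (tendsto_pi_nhds.1 (tendsto_pi_nhds.1 h2 l) b)
  simp only [zero_mul, Finset.sum_const_zero] at h3
  refine h3.congr' ?_
  filter_upwards [eventually_ne_atTop 0] with N hN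
  have hN' : (N : ℝ) ≠ 0 := Nat.cast_ne_zero.2 hN
  simp only [lsError, lsCoeff, mulVec, dotProduct, Matrix.of_apply, Matrix.smul_apply, smul_eq_mul,
    Finset.mul_sum, Finset.sum_mul, gram]
  rw [Finset.sum_comm]
  refine Finset.sum_congr rfl fun i _ => Finset.sum_congr rfl fun b _ => ?_
  field_simp

end Consistency

/-! ### The estimation error as a least squares error. -/

section Estimator

variable {D L : ℕ} {Ω : Type*} {X : ℕ → Ω → EuclideanSpace ℝ (Fin D)}
  {Y : ℕ → Ω → EuclideanSpace ℝ (Fin L)} (A : Matrix (Fin D) (Fin L) ℝ)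

lemma lsError_eq_mul (e : ℕ → Ω → EuclideanSpace ℝ (Fin D)) (N : ℕ) (ω : Ω) :
    lsError Y e N ω = dataMatrix e N ω * (dataMatrix Y N ω)ᵀ * (gram Y N ω)⁻¹ := by
  have hs : ((gram Y N ω)⁻¹)ᵀ = (gram Y N ω)⁻¹ := by
    simpa [gram] using (posSemidef_sumOuter fun (i : Fin N) a => Y i ω a).inv.1.eq
  have h : lsError Y e N ω = dataMatrix e N ω * ((gram Y N ω)⁻¹ * dataMatrix Y N ω)ᵀ := by
    ext a l; rfl
  rw [h, transpose_mul, hs, Matrix.mul_assoc]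

lemma AHat_sub_eq_lsError {N : ℕ} {ω : Ω} (h : (gram Y N ω).det ≠ 0) :
    AHat X Y N ω - A = lsError Y (fun i ω => X i ω - toEuclideanLin A (Y i ω)) N ω := by
  have hg : dataMatrix Y N ω * (dataMatrix Y N ω)ᵀ = gram Y N ω :=
    (gram_eq_mul_transpose Y N ω).symm
  have he : dataMatrix (fun i ω => X i ω - toEuclideanLin A (Y i ω)) N ω =
      dataMatrix X N ω - A * dataMatrix Y N ω := by
    ext a i
    simp [dataMatrix, Matrix.mul_apply, Matrix.mulVec, dotProduct]
  rw [lsError_eq_mul, he, AHat, hg, Matrix.sub_mul, Matrix.sub_mul, Matrix.mul_assoc A, hg,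
    Matrix.mul_assoc A, mul_nonsing_inv _ (isUnit_iff_ne_zero.2 h), Matrix.mul_one]

end Estimator

/-! ### Differentiability of g and its Jacobian in vectorised coordinates. -/

section Differentiability

variable {D L : ℕ} {Γ : Matrix (Fin L) (Fin L) ℝ} {S : Matrix (Fin D) (Fin D) ℝ}
  {A : Matrix (Fin D) (Fin L) ℝ}

/-- The inverse of a matrix depends differentiably on a parameter. -/
lemma differentiableAt_matrix_inv_apply {n E : Type*} [Fintype n] [DecidableEq n]
    [NormedAddCommGroup E] [NormedSpace ℝ E] {M : E → Matrix n n ℝ} {x : E}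
    (hM : ∀ i j, DifferentiableAt ℝ (fun y => M y i j) x) (h : (M x).det ≠ 0) (i j : n) :
    DifferentiableAt ℝ (fun y => (M y)⁻¹ i j) x := by
  have hdet : ∀ N : E → Matrix n n ℝ, (∀ i j, DifferentiableAt ℝ (fun y => N y i j) x) →
      DifferentiableAt ℝ (fun y => (N y).det) x := fun N hN => by
    simp only [Matrix.det_apply']
    exact DifferentiableAt.fun_sum fun σ _ =>
      ((HasFDerivAt.finsetProd (g := fun i y => N y (σ i) i)
        fun i _ => (hN _ _).hasFDerivAt).differentiableAt).const_mul _
  simp only [Matrix.inv_def, Ring.inverse_eq_inv', Matrix.smul_apply, smul_eq_mul,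
    Matrix.adjugate_apply]
  refine ((hdet M hM).inv h).mul (hdet _ fun k l => ?_)
  simp only [Matrix.updateRow_apply]
  split_ifs
  · exact differentiableAt_const _
  · exact hM _ _

lemma differentiableAt_g_apply (hΓ : Γ.PosDef) (hS : S.PosDef) (i : Fin L) (j : Fin D) :
    DifferentiableAt ℝ (fun M : Fin D → Fin L → ℝ => g Γ S (Matrix.of M) i j) A := by
  have hentry : ∀ i j, DifferentiableAt ℝ (fun M : Fin D → Fin L → ℝ => M i j) A := fun i j => by
    fun_prop
  have hinv : ∀ i j, DifferentiableAt ℝ (fun M : Fin D → Fin L → ℝ =>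
      (Γ⁻¹ + (Matrix.of M)ᵀ * S⁻¹ * Matrix.of M)⁻¹ i j) A := by
    refine differentiableAt_matrix_inv_apply (fun i j => ?_)
      (posDef_inv_add A hΓ hS).det_pos.ne'
    simp only [Matrix.add_apply, Matrix.mul_apply, Matrix.transpose_apply, Matrix.of_apply]
    fun_prop
  simp only [g, Matrix.mul_apply, Matrix.transpose_apply, Matrix.of_apply]
  exact DifferentiableAt.fun_sum fun k _ => (DifferentiableAt.fun_sum fun l _ =>
    (hinv i l).mul (hentry _ _)).mul_const _

lemma differentiableAt_g (hΓ : Γ.PosDef) (hS : S.PosDef) : DifferentiableAt ℝ (g Γ S) A := by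
  have h : DifferentiableAt ℝ (fun (M : Fin D → Fin L → ℝ) i j => g Γ S (Matrix.of M) i j) A :=
    differentiableAt_pi.2 fun i => differentiableAt_pi.2 fun j => differentiableAt_g_apply hΓ hS i j
  exact h

/-- The increment of `g` at `A`, between spaces of vectorised matrices. -/
noncomputable def vecIncrement (Γ : Matrix (Fin L) (Fin L) ℝ) (S : Matrix (Fin D) (Fin D) ℝ)
    (A : Matrix (Fin D) (Fin L) ℝ) (h : EuclideanSpace ℝ (Fin D × Fin L)) :
    EuclideanSpace ℝ (Fin D × Fin L) :=
  WithLp.toLp 2 (vec (g Γ S (A + Matrix.of fun a l => h (a, l)) - g Γ S A))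

/-- The matrix of the derivative of `g` at `A`, in vectorised coordinates. -/
noncomputable def jacobian (Γ : Matrix (Fin L) (Fin L) ℝ) (S : Matrix (Fin D) (Fin D) ℝ)
    (A : Matrix (Fin D) (Fin L) ℝ) : Matrix (Fin D × Fin L) (Fin D × Fin L) ℝ :=
  Matrix.of fun p q => vec (fderiv ℝ (g Γ S) A (Matrix.single q.1 q.2 1)) p

/-- The D × L argument is flattened by rows and the L × D value by columns, so both are indexed by
`Fin D × Fin L` and the Jacobian is square. -/
lemma vec_fderiv_g (H : Matrix (Fin D) (Fin L) ℝ) :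
    vec (fderiv ℝ (g Γ S) A H) = jacobian Γ S A *ᵥ fun p => H p.1 p.2 := by
  ext p
  conv_lhs => rw [Matrix.matrix_eq_sum_single H]
  simp only [map_sum, mulVec, dotProduct, Fintype.sum_prod_type, jacobian, Matrix.of_apply, vec]
  simp only [Matrix.sum_apply]
  refine Finset.sum_congr rfl fun a _ => Finset.sum_congr rfl fun l _ => ?_
  have : Matrix.single a l (H a l) = H a l • Matrix.single a l (1 : ℝ) := by
    rw [Matrix.smul_single, smul_eq_mul, mul_one]
  rw [this, map_smul, Matrix.smul_apply, smul_eq_mul, mul_comm]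

lemma hasFDerivAt_vecIncrement (hΓ : Γ.PosDef) (hS : S.PosDef) :
    HasFDerivAt (vecIncrement Γ S A) (toEuclideanCLM (𝕜 := ℝ) (jacobian Γ S A)) 0 := by
  have h0 : HasFDerivAt (g Γ S) (fderiv ℝ (g Γ S) A) A := (differentiableAt_g hΓ hS).hasFDerivAt
  set G : (Fin D → Fin L → ℝ) →L[ℝ] Fin L → Fin D → ℝ := fderiv ℝ (g Γ S) A with hG
  let φ : EuclideanSpace ℝ (Fin D × Fin L) →L[ℝ] Fin D → Fin L → ℝ :=
    ContinuousLinearMap.pi fun a => ContinuousLinearMap.pi fun l => EuclideanSpace.proj (a, l)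
  let ψ : (Fin L → Fin D → ℝ) →L[ℝ] EuclideanSpace ℝ (Fin D × Fin L) :=
    (PiLp.continuousLinearEquiv 2 ℝ fun _ : Fin D × Fin L => ℝ).symm.toContinuousLinearMap ∘L
      ContinuousLinearMap.pi fun p =>
        ContinuousLinearMap.proj (R := ℝ) p.1 ∘L ContinuousLinearMap.proj p.2
  have h1 : HasFDerivAt (fun (M : Fin D → Fin L → ℝ) i j =>
      g Γ S (Matrix.of M) i j - g Γ S A i j) G ((fun a l => A a l) + φ 0) := by
    rw [map_zero, add_zero]
    exact HasFDerivAt.sub_const (f := fun (M : Fin D → Fin L → ℝ) i j => g Γ S (Matrix.of M) i j)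
      (fun i j => g Γ S A i j) h0
  have h2 := (ψ.hasFDerivAt (x := _)).comp 0
    (h1.comp 0 ((φ.hasFDerivAt (x := 0)).const_add fun a l => A a l))
  have h3 : ψ ∘L G ∘L φ = toEuclideanCLM (𝕜 := ℝ) (jacobian Γ S A) := by
    ext h p
    have := congrFun (vec_fderiv_g (Γ := Γ) (S := S) (A := A) (Matrix.of fun a l => h (a, l))) p
    exact this
  rw [h3] at h2
  exact h2

lemma measurable_vecIncrement : Measurable (vecIncrement Γ S A) := by
  refine (MeasurableEquiv.toLp 2 (Fin D × Fin L → ℝ)).measurable.comp (measurable_pi_iff.2 fun p => ?_)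
  have hinv : ∀ i j, Measurable fun h : EuclideanSpace ℝ (Fin D × Fin L) =>
      (Γ⁻¹ + (A + Matrix.of fun a l => h (a, l))ᵀ * S⁻¹ *
        (A + Matrix.of fun a l => h (a, l)))⁻¹ i j := by
    refine measurable_matrix_inv_apply fun i j => ?_
    simp only [Matrix.add_apply, Matrix.mul_apply, Matrix.transpose_apply, Matrix.of_apply]
    fun_prop
  simp only [vec, g, Matrix.sub_apply]
  refine Measurable.sub_const ?_ _
  simp only [Matrix.mul_apply]
  refine Finset.measurable_sum _ fun k _ => (Finset.measurable_sum _ fun l _ =>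
    (hinv _ l).mul ?_).mul_const _
  simp only [Matrix.add_apply, Matrix.transpose_apply, Matrix.of_apply]
  fun_prop

end Differentiability

/-! ### The χ² law: Gaussian quadratic forms, absence of atoms, quantiles. -/

section ChiSquared

open scoped MatrixOrder

/-- The quadratic form of the inverse covariance matrix of a centred Gaussian vector is
chi-squared distributed. -/
lemma map_quadratic_multivariateGaussian {ι : Type*} [Fintype ι] [DecidableEq ι]
    {K : Matrix ι ι ℝ} (hK : K.PosDef) :
    (multivariateGaussian 0 K).map (fun x => x.ofLp ⬝ᵥ (K⁻¹ *ᵥ x.ofLp)) =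
      chiSq (Fintype.card ι) := by
  set R := CFC.sqrt K with hR
  have hRR : R * R = K := CFC.sqrt_mul_sqrt_self K hK.posSemidef.nonneg
  have hRu : IsUnit R.det := isUnit_det_cfcSqrt hK
  have hRt : Rᵀ = R := isHermitian_cfcSqrt K
  -- A vector of law N(0, K) is R = K^(1/2) applied to a standard one, for which the form is the
  -- squared norm.
  have hq : ∀ x : ι → ℝ, (R *ᵥ x) ⬝ᵥ (K⁻¹ *ᵥ (R *ᵥ x)) = ∑ i, x i ^ 2 := fun x => by
    have h1 : R * (K⁻¹ * R) = 1 := by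
      rw [← hRR, Matrix.mul_inv_rev, Matrix.mul_assoc, nonsing_inv_mul _ hRu, Matrix.mul_one,
        mul_nonsing_inv _ hRu]
    have h2 : (R *ᵥ x) ⬝ᵥ (K⁻¹ *ᵥ (R *ᵥ x)) = x ⬝ᵥ (Rᵀ *ᵥ (K⁻¹ *ᵥ (R *ᵥ x))) := by
      rw [dotProduct_mulVec x, vecMul_transpose]
    rw [h2, hRt, mulVec_mulVec, mulVec_mulVec, Matrix.mul_assoc, h1, one_mulVec]
    simp [dotProduct, sq]
  have hm : Measurable fun x : EuclideanSpace ℝ ι => x.ofLp ⬝ᵥ (K⁻¹ *ᵥ x.ofLp) := by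
    simp only [dotProduct, mulVec]; fun_prop
  have hpres := measurePreserving_piCongrLeft (fun _ : Fin (Fintype.card ι) => gaussianReal 0 1)
    (Fintype.equivFin ι)
  rw [chiSq, ← hpres.map_eq, Measure.map_map (by fun_prop) hpres.measurable, multivariateGaussian,
    ← map_pi_eq_stdGaussian, Measure.map_map hm (by fun_prop),
    Measure.map_map (hm.comp (by fun_prop)) (by fun_prop)]
  congr 1
  ext x
  simp only [Function.comp_apply, zero_add, toEuclideanCLM_toLp, ← hR, hq]
  rw [← (Fintype.equivFin ι).sum_comp]
  refine Finset.sum_congr rfl fun i _ => ?_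
  rw [MeasurableEquiv.coe_piCongrLeft, Equiv.piCongrLeft_apply_apply]

instance isProbabilityMeasure_chiSq (k : ℕ) : IsProbabilityMeasure (chiSq k) :=
  Measure.isProbabilityMeasure_map
    (Measurable.aemeasurable (f := fun x : Fin k → ℝ => ∑ i, x i ^ 2) (by fun_prop))

/-- Given all coordinates but the first, at most two values of the first produce a prescribed sum of
squares. For k = 0 the law is a point mass. -/
lemma nullSingletonClass_chiSq {k : ℕ} (hk : 0 < k) : NullSingletonClass (chiSq k) := by
  refine ⟨fun r => ?_⟩
  obtain ⟨m, rfl⟩ := Nat.exists_eq_succ_of_ne_zero hk.ne'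
  have := nullSingletonClass_gaussianReal (μ := 0) (v := 1) one_ne_zero
  have hpres := measurePreserving_piFinSuccAbove (fun _ : Fin (m + 1) => gaussianReal 0 1) 0
  set T : Set (ℝ × (Fin m → ℝ)) := {p | p.1 ^ 2 + ∑ i, p.2 i ^ 2 = r} with hT
  have hTm : MeasurableSet T := measurableSet_eq_fun (by fun_prop) (by fun_prop)
  have hpre : (fun x : Fin (m + 1) → ℝ => ∑ i, x i ^ 2) ⁻¹' {r} =
      MeasurableEquiv.piFinSuccAbove (fun _ => ℝ) 0 ⁻¹' T := by
    ext x
    simp [hT, Fin.sum_univ_succ, Fin.tail]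
  rw [chiSq, Measure.map_apply (by fun_prop) (measurableSet_singleton r), hpre,
    hpres.measure_preimage hTm.nullMeasurableSet, Measure.prod_apply_symm hTm]
  refine (lintegral_congr fun y => ?_).trans lintegral_zero
  refine Set.Finite.measure_zero (Set.Finite.subset
    (Set.toFinite {√(r - ∑ i, y i ^ 2), -√(r - ∑ i, y i ^ 2)}) fun t ht => ?_) _
  have ht' : t ^ 2 + ∑ i, y i ^ 2 = r := ht
  have : √(r - ∑ i, y i ^ 2) = |t| := by rw [← ht', add_sub_cancel_right, Real.sqrt_sq_eq_abs]
  rw [this]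
  rcases abs_choice t with h | h <;> simp [h]

/-- Without atoms the distribution function F is continuous: {F ≥ p} is closed and contains its
infimum, while F < p to the left of it gives the other inequality. -/
lemma real_Iic_chiSqQuantile {k : ℕ} (hk : 0 < k) {p : ℝ} (hp0 : 0 < p) (hp1 : p < 1) :
    (chiSq k).real (Set.Iic (chiSqQuantile k p)) = p := by
  have := nullSingletonClass_chiSq hk
  have hF : ∀ x, (chiSq k).real (Set.Iic x) = cdf (chiSq k) x := fun x => (cdf_eq_real _ x).symm
  have hcont : Continuous (cdf (chiSq k)) := by
    rw [continuous_iff_continuousAt]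
    intro x
    refine (monotone_cdf _).continuousAt_iff_leftLim_eq_rightLim.2 ?_
    have h1 := (cdf (chiSq k)).measure_singleton x
    rw [measure_cdf, measure_singleton] at h1
    have h2 := ENNReal.ofReal_eq_zero.1 h1.symm
    rw [StieltjesFunction.rightLim_eq]
    exact le_antisymm ((monotone_cdf _).leftLim_le le_rfl) (by linarith)
  have hset : chiSqQuantile k p = sInf {x | p ≤ cdf (chiSq k) x} := by
    simp only [chiSqQuantile, hF]
  rw [hF, hset]
  set s : Set ℝ := {x | p ≤ cdf (chiSq k) x} with hs
  have hne : s.Nonempty :=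
    ((tendsto_cdf_atTop (chiSq k)).eventually (eventually_ge_nhds hp1)).exists
  obtain ⟨b, hb⟩ := ((tendsto_cdf_atBot (chiSq k)).eventually (eventually_lt_nhds hp0)).exists
  have hbdd : BddBelow s := ⟨b, fun x hx => le_of_not_gt fun h =>
    absurd (hx.trans (monotone_cdf _ h.le)) (not_le.2 hb)⟩
  refine le_antisymm ?_ ((isClosed_le continuous_const hcont).csInf_mem hne hbdd)
  refine le_of_tendsto (hcont.continuousWithinAt (s := Set.Iio (sInf s))) ?_
  filter_upwards [self_mem_nhdsWithin] with x hx
  exact (not_le.1 (notMem_of_lt_csInf (s := s) hx hbdd)).le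

end ChiSquared

/-! ### Delta method and convergence of distribution functions. -/

section Delta

variable {Ω Ω' E F : Type*} [MeasurableSpace Ω] {P : Measure Ω} [IsProbabilityMeasure P]
  [MeasurableSpace Ω'] {P' : Measure Ω'} [IsProbabilityMeasure P']
  [NormedAddCommGroup E] [NormedSpace ℝ E] [MeasurableSpace E] [BorelSpace E]
  [SecondCountableTopology E]
  [NormedAddCommGroup F] [NormedSpace ℝ F] [MeasurableSpace F] [BorelSpace F]
  [SecondCountableTopology F]

/-- The delta method. -/
lemma tendstoInDistribution_delta {f : E → F} {f' : E →L[ℝ] F} (hf : HasFDerivAt f f' 0)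
    (hf0 : f 0 = 0) (hfm : Measurable f) {h : ℕ → Ω → E} {r : ℕ → ℝ} (hr : ∀ N, 0 ≤ r N)
    {Z : Ω' → E} (hdist : TendstoInDistribution (fun N ω => r N • h N ω) atTop Z (fun _ => P) P')
    (hh : ∀ᵐ ω ∂P, Tendsto (fun N => h N ω) atTop (𝓝 0)) (hhm : ∀ N, AEMeasurable (h N) P) :
    TendstoInDistribution (fun N ω => r N • f (h N ω)) atTop (fun ω => f' (Z ω))
      (fun _ => P) P' := by
  -- The normalised remainder, equal to 0 at 0. Then r f(h) = f'(r h) + ‖r h‖ ρ(h) with ρ(h) → 0,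
  -- and Slutsky applies.
  set ρ : E → F := fun x => ‖x‖⁻¹ • (f x - f' x) with hρ
  have hρm : Measurable ρ := by
    have := f'.measurable
    exact measurable_norm.inv.smul (hfm.sub this)
  have hρ0 : Tendsto ρ (𝓝 0) (𝓝 0) := by
    have := hasFDerivAt_iff_tendsto.1 hf
    rw [tendsto_zero_iff_norm_tendsto_zero]
    simpa [hρ, norm_smul, hf0] using this
  have hs := hdist.continuous_comp_prodMk_of_tendstoInMeasure_const
    (g := fun p : E × F => f' p.1 + ‖p.1‖ • p.2) (by fun_prop)
    (tendstoInMeasure_of_tendsto_ae (f := fun N ω => ρ (h N ω)) (g := fun _ => (0 : F))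
      (fun N => (hρm.comp_aemeasurable (hhm N)).aestronglyMeasurable)
      (hh.mono fun ω hω => hρ0.comp hω)) (fun N => hρm.comp_aemeasurable (hhm N))
  simp only [smul_zero, add_zero] at hs
  convert! hs using 3 with N ω
  by_cases hx : h N ω = 0
  · simp [hx, hf0]
  · have : ‖h N ω‖ ≠ 0 := norm_ne_zero_iff.2 hx
    rw [hρ, map_smul, norm_smul, Real.norm_of_nonneg (hr N), smul_smul, mul_assoc,
      mul_inv_cancel₀ this, mul_one, ← smul_add, add_sub_cancel]

/-- Convergence in distribution to a law without atoms implies convergence of the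
distribution functions. -/
lemma tendsto_real_le_of_tendstoInDistribution {q : ℕ → Ω → ℝ} {Z : Ω' → ℝ}
    (h : TendstoInDistribution q atTop Z (fun _ => P) P') (c : ℝ) (hc : P'.map Z {c} = 0) :
    Tendsto (fun N => P.real {ω | q N ω ≤ c}) atTop (𝓝 ((P'.map Z).real (Set.Iic c))) := by
  have h1 := ProbabilityMeasure.tendsto_measure_of_null_frontier_of_tendsto' h.tendsto
    (E := Set.Iic c) (by simpa [frontier_Iic] using hc)
  have := Measure.isProbabilityMeasure_map h.aemeasurable_limit
  have h2 := (ENNReal.tendsto_toReal (measure_ne_top (P'.map Z) (Set.Iic c))).comp h1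
  refine h2.congr fun N => ?_
  simp only [Function.comp_apply, ProbabilityMeasure.coe_mk]
  rw [Measure.map_apply_of_aemeasurable (h.forall_aemeasurable N) measurableSet_Iic]
  rfl

end Delta

/-! ### Covariance of a linear image. -/

section Covariance

variable {Ω ι : Type*} [MeasurableSpace Ω] {P : Measure Ω} [IsProbabilityMeasure P] [Fintype ι]
  {h : ι → Ω → ℝ}

omit [IsProbabilityMeasure P] in
lemma memLp_mulVec (hh : ∀ r, MemLp (h r) 2 P) (J : Matrix ι ι ℝ) (p : ι) :
    MemLp (fun ω => (J *ᵥ fun r => h r ω) p) 2 P :=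
  memLp_finsetSum _ fun r _ => (hh r).const_mul (J p r)

lemma covariance_mulVec (hh : ∀ r, MemLp (h r) 2 P) (h0 : ∀ r, ∫ ω, h r ω ∂P = 0)
    (J : Matrix ι ι ℝ) (p q : ι) :
    covariance (fun ω => (J *ᵥ fun r => h r ω) p) (fun ω => (J *ᵥ fun r => h r ω) q) P =
      (J * (Matrix.of fun r s => ∫ ω, h r ω * h s ω ∂P) * Jᵀ) p q := by
  simp only [mulVec, dotProduct]
  rw [covariance_fun_sum_fun_sum (fun r => (hh r).const_mul (J p r))
    (fun r => (hh r).const_mul (J q r))]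
  simp only [covariance_const_mul_left, covariance_const_mul_right, covariance_eq_sub (hh _) (hh _),
    h0, Matrix.mul_apply, Finset.sum_mul, Matrix.transpose_apply, Matrix.of_apply, Pi.mul_apply]
  rw [Finset.sum_comm]
  refine Finset.sum_congr rfl fun s _ => Finset.sum_congr rfl fun r _ => ?_
  ring

end Covariance

lemma vecIncrement_zero {D L : ℕ} {Γ : Matrix (Fin L) (Fin L) ℝ} {S : Matrix (Fin D) (Fin D) ℝ}
    {A : Matrix (Fin D) (Fin L) ℝ} : vecIncrement Γ S A 0 = 0 := by
  have : A + Matrix.of (fun (_ : Fin D) (_ : Fin L) => (0 : ℝ)) = A := add_zero A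
  simp [vecIncrement, this]

/-! ### Asymptotics of Θ and of the quadratic form. -/

section Theta

variable {D L : ℕ} {Ω : Type*} [MeasurableSpace Ω] {P : Measure Ω} [IsProbabilityMeasure P]
  {Γ : Matrix (Fin L) (Fin L) ℝ} {S : Matrix (Fin D) (Fin D) ℝ} {A : Matrix (Fin D) (Fin L) ℝ}
  {X : ℕ → Ω → EuclideanSpace ℝ (Fin D)} {Y : ℕ → Ω → EuclideanSpace ℝ (Fin L)}
  (hΓ : Γ.PosDef) (hS : S.PosDef)
  (hXY : IsForwardSample P (S + A * Γ * Aᵀ) (g Γ S A) (sigmaStar Γ S A) X Y)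
include hΓ hS hXY

lemma ae_AHat_sub_eq_lsError {N : ℕ} (hN : L + 1 < N) : ∀ᵐ ω ∂P, AHat X Y N ω - A =
    lsError Y (fun i ω => X i ω - toEuclideanLin A (Y i ω)) N ω := by
  filter_upwards [ae_det_gram_ne_zero hΓ (iIndepFun_left (hXY.iIndepFun_inverse A))
    (hasLaw_left (hXY.hasLaw_inverse A hΓ hS)) (by simpa using hN)] with ω hω
  exact AHat_sub_eq_lsError A hω

lemma ae_linearizedError_eq {N : ℕ} (hN : L + 1 < N) : ∀ᵐ ω ∂P,
    linearizedError Γ S A X Y N ω = jacobian Γ S A *ᵥ fun p =>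
      lsError Y (fun i ω => X i ω - toEuclideanLin A (Y i ω)) N ω p.1 p.2 := by
  filter_upwards [ae_AHat_sub_eq_lsError hΓ hS hXY hN] with ω hω
  rw [linearizedError, hω, vec_fderiv_g]

lemma memLp_linearizedError {N : ℕ} (hN : L + 1 < N) (p : Fin D × Fin L) :
    MemLp (fun ω => linearizedError Γ S A X Y N ω p) 2 P := by
  refine MemLp.ae_eq ?_ (memLp_mulVec (fun p : Fin D × Fin L =>
    memLp_lsError (hXY.hasLaw_inverse A hΓ hS) (hXY.iIndepFun_inverse A) hΓ (by simpa using hN)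
      p.1 p.2) (jacobian Γ S A) p)
  filter_upwards [ae_linearizedError_eq hΓ hS hXY hN] with ω hω
  rw [hω]

lemma Theta_eq {N : ℕ} (hN : L + 1 < N) : Theta P Γ S A X Y N =
    jacobian Γ S A * (S ⊗ₖ Matrix.of fun l m => ∫ ω, (gram Y N ω)⁻¹ l m ∂P) *
      (jacobian Γ S A)ᵀ := by
  have hlaw := hXY.hasLaw_inverse A hΓ hS
  have hpair := hXY.iIndepFun_inverse A
  have hN' : Fintype.card (Fin L) + 1 < N := by simpa using hN
  set h : Fin D × Fin L → Ω → ℝ := fun p ω =>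
    lsError Y (fun i ω => X i ω - toEuclideanLin A (Y i ω)) N ω p.1 p.2 with hh
  have hC : (S ⊗ₖ Matrix.of fun l m => ∫ ω, (gram Y N ω)⁻¹ l m ∂P) = Matrix.of fun p q =>
      ∫ ω, h p ω * h q ω ∂P := by
    ext p q
    exact (integral_lsError_mul hlaw hpair hΓ hS.posSemidef hN' p.1 q.1 p.2 q.2).symm
  have hae : ∀ᵐ ω ∂P, linearizedError Γ S A X Y N ω = jacobian Γ S A *ᵥ fun p => h p ω :=
    ae_linearizedError_eq hΓ hS hXY hN
  have hp := fun p => hae.mono fun ω hω => congrFun hω p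
  have hcov := covariance_mulVec (P := P) (h := h)
    (fun p => memLp_lsError hlaw hpair hΓ hN' p.1 p.2)
    (fun p => integral_lsError hlaw hpair hΓ hN' p.1 p.2) (jacobian Γ S A)
  clear_value h
  ext p q
  rw [hC, ← hcov, Theta, Matrix.of_apply, covariance, covariance, integral_congr_ae (hp p),
    integral_congr_ae (hp q)]
  refine integral_congr_ae ?_
  filter_upwards [hp p, hp q] with ω h1 h2
  rw [h1, h2]

/-- Here the convergence of the mean of N gram⁻¹ is used, since Θ is an exact covariance at each N.
-/
lemma tendsto_Theta : Tendsto (fun N : ℕ => (N : ℝ) • Theta P Γ S A X Y N) atTop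
    (𝓝 (jacobian Γ S A * (S ⊗ₖ Γ⁻¹) * (jacobian Γ S A)ᵀ)) := by
  have h1 : Tendsto (fun N : ℕ => S ⊗ₖ Matrix.of fun l m => (N : ℝ) *
      ∫ ω, (gram Y N ω)⁻¹ l m ∂P) atTop (𝓝 (S ⊗ₖ Γ⁻¹)) := by
    refine tendsto_pi_nhds.2 fun p => tendsto_pi_nhds.2 fun q => Tendsto.const_mul _ ?_
    exact tendsto_integral_inv_gram hΓ (iIndepFun_left (hXY.iIndepFun_inverse A))
      (hasLaw_left (hXY.hasLaw_inverse A hΓ hS)) p.2 q.2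
  have h2 : Continuous fun M : Matrix (Fin D × Fin L) (Fin D × Fin L) ℝ =>
      jacobian Γ S A * M * (jacobian Γ S A)ᵀ := by fun_prop
  refine ((h2.tendsto _).comp h1).congr' ?_
  filter_upwards [eventually_gt_atTop (L + 1)] with N hN
  rw [Theta_eq hΓ hS hXY hN, ← Matrix.smul_mul, ← Matrix.mul_smul, ← kronecker_smul]
  rfl

/-- A single N > L + 1 with Θ invertible suffices, because det J is a factor of det Θ. -/
lemma isUnit_det_jacobian (hΘ : ∀ᶠ N in atTop, IsUnit (Theta P Γ S A X Y N)) :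
    IsUnit (jacobian Γ S A).det := by
  obtain ⟨N, hu, hN⟩ := (hΘ.and (eventually_gt_atTop (L + 1))).exists
  rw [Matrix.isUnit_iff_isUnit_det, Theta_eq hΓ hS hXY hN, det_mul, det_transpose] at hu
  exact isUnit_of_mul_isUnit_right hu

lemma tendstoInDistribution_vecIncrement : TendstoInDistribution
    (fun (N : ℕ) ω => √(N : ℝ) • vecIncrement Γ S A (WithLp.toLp 2 fun p =>
      lsError Y (fun i ω => X i ω - toEuclideanLin A (Y i ω)) N ω p.1 p.2)) atTop
    (fun z => toEuclideanCLM (𝕜 := ℝ) (jacobian Γ S A) z) (fun _ => P)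
    (multivariateGaussian 0 (S ⊗ₖ Γ⁻¹)) := by
  have hlaw := hXY.hasLaw_inverse A hΓ hS
  have hpair := hXY.iIndepFun_inverse A
  refine tendstoInDistribution_delta (hasFDerivAt_vecIncrement hΓ hS) ?_ measurable_vecIncrement
    (fun N => Real.sqrt_nonneg _) (Z := id) ?_ ?_ fun N => ?_
  · exact vecIncrement_zero
  · exact tendstoInDistribution_scaledError hlaw hpair hΓ hS.posSemidef
  · filter_upwards [ae_all_iff.2 fun p : Fin D × Fin L =>
      ae_tendsto_lsError hΓ hlaw hpair p.1 p.2] with ω hω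
    exact ((PiLp.continuous_toLp 2 fun _ : Fin D × Fin L => ℝ).tendsto 0).comp
      (tendsto_pi_nhds.2 hω)
  · exact (MeasurableEquiv.toLp 2 (Fin D × Fin L → ℝ)).measurable.comp_aemeasurable
      (aemeasurable_pi_lambda _ fun p => aemeasurable_lsError hlaw N p.1 p.2)

/-- The quadratic form of the confidence ellipsoid, as a function of the least squares error. -/
lemma tendstoInDistribution_quadratic (hJ : IsUnit (jacobian Γ S A).det) :
    TendstoInDistribution (fun (N : ℕ) ω =>
      let u := (vecIncrement Γ S A (WithLp.toLp 2 fun p =>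
        lsError Y (fun i ω => X i ω - toEuclideanLin A (Y i ω)) N ω p.1 p.2)).ofLp
      u ⬝ᵥ ((Theta P Γ S A X Y N)⁻¹ *ᵥ u)) atTop
    (fun z => z.ofLp ⬝ᵥ ((S ⊗ₖ Γ⁻¹)⁻¹ *ᵥ z.ofLp)) (fun _ => P)
    (multivariateGaussian 0 (S ⊗ₖ Γ⁻¹)) := by
  set J := jacobian Γ S A with hJdef
  set K := S ⊗ₖ Γ⁻¹ with hK
  have hKpos : K.PosDef := hS.kronecker hΓ.inv
  have hV : (J * K * Jᵀ).det ≠ 0 := by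
    rw [det_mul, det_mul, det_transpose]
    exact mul_ne_zero (mul_ne_zero hJ.ne_zero hKpos.det_pos.ne') hJ.ne_zero
  -- (NΘ)⁻¹ is deterministic and convergent, so Slutsky pairs it with √N times the increment; the
  -- powers of N cancel.
  have hinv := tendsto_matrix_inv hV (tendsto_Theta hΓ hS hXY)
  have hs := (tendstoInDistribution_vecIncrement hΓ hS
    hXY).continuous_comp_prodMk_of_tendstoInMeasure_const
    (E' := Fin D × Fin L → Fin D × Fin L → ℝ)
    (g := fun p : EuclideanSpace ℝ (Fin D × Fin L) × (Fin D × Fin L → Fin D × Fin L → ℝ) =>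
      p.1.ofLp ⬝ᵥ (Matrix.of p.2 *ᵥ p.1.ofLp))
    (by simp only [dotProduct, mulVec, Matrix.of_apply]; fun_prop)
    (Y := fun (N : ℕ) _ => Matrix.of.symm ((N : ℝ) • Theta P Γ S A X Y N)⁻¹)
    (c := Matrix.of.symm (J * K * Jᵀ)⁻¹)
    (tendstoInMeasure_of_tendsto_ae (fun N => aestronglyMeasurable_const)
      (ae_of_all _ fun _ => hinv)) (fun N => aemeasurable_const)
  have hz : ∀ z : EuclideanSpace ℝ (Fin D × Fin L), z.ofLp ⬝ᵥ (K⁻¹ *ᵥ z.ofLp) =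
      (J *ᵥ z.ofLp) ⬝ᵥ ((J * K * Jᵀ)⁻¹ *ᵥ (J *ᵥ z.ofLp)) := fun z => by
    -- The Jacobian cancels, so the limit law does not depend on it.
    have h1 : Jᵀ * ((J * K * Jᵀ)⁻¹ * J) = K⁻¹ := by
      have hJt : IsUnit Jᵀ.det := by rwa [det_transpose]
      rw [Matrix.mul_inv_rev, Matrix.mul_inv_rev, Matrix.mul_assoc, Matrix.mul_assoc,
        nonsing_inv_mul _ hJ, Matrix.mul_one, ← Matrix.mul_assoc, mul_nonsing_inv _ hJt,
        Matrix.one_mul]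
    rw [← h1, ← mulVec_mulVec, ← mulVec_mulVec, dotProduct_mulVec, vecMul_transpose]
  simp only [hz]
  convert! hs using 3 with N ω z
  · simp only [Equiv.apply_symm_apply, WithLp.ofLp_smul, mulVec_smul, dotProduct_smul,
      smul_dotProduct, smul_eq_mul]
    -- For N = 0 the scaling cannot be undone, but the error is an empty sum and the increment
    -- vanishes.
    rcases eq_or_ne N 0 with rfl | hN
    · have h0 : (WithLp.toLp 2 fun p : Fin D × Fin L =>
          lsError Y (fun i ω => X i ω - toEuclideanLin A (Y i ω)) 0 ω p.1 p.2) = 0 := by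
        ext p; simp [lsError]
      rw [h0, vecIncrement_zero]
      simp
    · have hN' : (N : ℝ) ≠ 0 := Nat.cast_ne_zero.2 hN
      rw [matrix_inv_smul hN', smul_mulVec, dotProduct_smul, smul_eq_mul, ← mul_assoc, ← mul_assoc,
        Real.mul_self_sqrt (Nat.cast_nonneg N), mul_inv_cancel₀ hN', one_mul]

end Theta

/-! ### Coverage of the confidence ellipsoid. -/

section Coverage

variable {D L : ℕ} {Ω : Type*} [MeasurableSpace Ω] {P : Measure Ω} [IsProbabilityMeasure P]
  {Γ : Matrix (Fin L) (Fin L) ℝ} {S : Matrix (Fin D) (Fin D) ℝ} {A : Matrix (Fin D) (Fin L) ℝ}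
  {X : ℕ → Ω → EuclideanSpace ℝ (Fin D)} {Y : ℕ → Ω → EuclideanSpace ℝ (Fin L)}

omit [IsProbabilityMeasure P] in
-- The vector A⋆ - Â⋆ is minus the increment of g, and the quadratic form is even.
lemma mem_confidenceRegion_iff (α : ℝ) {N : ℕ} {ω : Ω}
    (h : AHat X Y N ω - A = lsError Y (fun i ω => X i ω - toEuclideanLin A (Y i ω)) N ω) :
    g Γ S A ∈ confidenceRegion P Γ S A X Y α N ω ↔
      let u := (vecIncrement Γ S A (WithLp.toLp 2 fun p =>
        lsError Y (fun i ω => X i ω - toEuclideanLin A (Y i ω)) N ω p.1 p.2)).ofLp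
      u ⬝ᵥ ((Theta P Γ S A X Y N)⁻¹ *ᵥ u) ≤ chiSqQuantile (D * L) (1 - α) := by
  have hA : A + Matrix.of (fun a l =>
      lsError Y (fun i ω => X i ω - toEuclideanLin A (Y i ω)) N ω a l) = AHat X Y N ω := by
    rw [← h]; exact add_sub_cancel _ _
  have hu : vec (g Γ S A - AStarHat Γ S X Y N ω) = -(vecIncrement Γ S A (WithLp.toLp 2 fun p =>
      lsError Y (fun i ω => X i ω - toEuclideanLin A (Y i ω)) N ω p.1 p.2)).ofLp := by
    simp only [vecIncrement, hA, AStarHat]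
    ext p
    simp [vec]
  simp only [confidenceRegion, Set.mem_ofPred_eq, hu, mulVec_neg, neg_dotProduct_neg]

lemma tendsto_coverage (hD : 0 < D) (hL : 0 < L) (hΓ : Γ.PosDef) (hS : S.PosDef)
    (hXY : IsForwardSample P (S + A * Γ * Aᵀ) (g Γ S A) (sigmaStar Γ S A) X Y)
    (hΘ : ∀ᶠ N in atTop, IsUnit (Theta P Γ S A X Y N)) {α : ℝ} (hα0 : 0 < α) (hα1 : α < 1) :
    Tendsto (fun N => P.real {ω | g Γ S A ∈ confidenceRegion P Γ S A X Y α N ω}) atTop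
      (𝓝 (1 - α)) := by
  have hk : 0 < D * L := Nat.mul_pos hD hL
  have hq := map_quadratic_multivariateGaussian (hS.kronecker hΓ.inv)
  rw [Fintype.card_prod, Fintype.card_fin, Fintype.card_fin] at hq
  have := nullSingletonClass_chiSq hk
  have h := tendsto_real_le_of_tendstoInDistribution
    (tendstoInDistribution_quadratic hΓ hS hXY (isUnit_det_jacobian hΓ hS hXY hΘ))
    (chiSqQuantile (D * L) (1 - α)) (by rw [hq]; exact measure_singleton _)
  rw [hq, real_Iic_chiSqQuantile hk (by linarith) (by linarith)] at h
  refine h.congr' ?_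
  -- Beyond L + 1 observations the Gram matrix is almost surely invertible, so Â - A is the least
  -- squares error off a null set.
  filter_upwards [eventually_gt_atTop (L + 1)] with N hN
  refine measureReal_congr ?_
  filter_upwards [ae_AHat_sub_eq_lsError hΓ hS hXY hN] with ω hω
  exact propext (mem_confidenceRegion_iff α hω).symm

end Coverage

end InverseRegression

theorem mainTheorem3 {Ω : Type*} [MeasurableSpace Ω] (P : Measure Ω) [IsProbabilityMeasure P]
    {D L : ℕ} (hD : 0 < D) (hL : 0 < L)
    (Γ : Matrix (Fin L) (Fin L) ℝ) (hΓ : Γ.PosDef)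
    (A : Matrix (Fin D) (Fin L) ℝ)
    (S : Matrix (Fin D) (Fin D) ℝ) (hS : S.PosDef) (hSdiag : S.IsDiag)
    (Γs : Matrix (Fin D) (Fin D) ℝ) (As : Matrix (Fin L) (Fin D) ℝ)
    (Ss : Matrix (Fin L) (Fin L) ℝ)
    (hΨ : InverseRegression.Psi Γ A S = (Γs, As, Ss))
    (X : ℕ → Ω → EuclideanSpace ℝ (Fin D)) (Y : ℕ → Ω → EuclideanSpace ℝ (Fin L))
    (hXY : InverseRegression.IsForwardSample P Γs As Ss X Y)
    (hΘ : ∀ᶠ N in atTop, IsUnit (InverseRegression.Theta P Γ S A X Y N))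
    (α : ℝ) (hα0 : 0 < α) (hα1 : α < 1) :
    (∀ᶠ N in atTop, ∀ p,
      MemLp (fun ω => InverseRegression.linearizedError Γ S A X Y N ω p) 2 P) ∧
    Tendsto
      (fun N => P.real {ω | As ∈ InverseRegression.confidenceRegion P Γ S A X Y α N ω})
      atTop (𝓝 (1 - α)) := by
  simp only [InverseRegression.Psi, Prod.mk.injEq] at hΨ
  obtain ⟨rfl, rfl, rfl⟩ := hΨ
  refine ⟨?_, InverseRegression.tendsto_coverage hD hL hΓ hS hXY hΘ hα0 hα1⟩
  filter_upwards [eventually_gt_atTop (L + 1)] with N hN p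
  exact InverseRegression.memLp_linearizedError hΓ hS hXY hN p
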